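/- Let $N,d,p,q$ be natural numbers, let $B_1,\dots,B_q$ and $A_1,\dots,A_p$ be real $N\times N$ matrices, and let $\Gamma$ be a real $N\times d$ matrix. Let $X=(X_t)_{t\in\mathbb Z}$ be a (strictly) stationary and ergodic process in $\mathbb R^d$, defined on a probability space $(\Omega_0,P_0)$, with $\mathbb E\log_+|X_0|<\infty$. Let $\nu$ be a probability measure on $\mathbb R^N$ (the distribution of the noise $\varepsilon_0$) whose support is all of $\mathbb R^N$ and whose cumulative distribution function $x\mapsto\nu(\prod_i(-\infty,x_i])$ is Lipschitz. Assume that all complex roots of $$\mathcal P(z)=\det\Bigl(I_N-\sum_{j=1}^q B_jz^j\Bigr)$$ satisfy $|z|>1$. For $I\subset\{1,\dots,N\}$ and $c\in\mathbb R^N$ let $\mathbf 1_I\in\{0,1\}^N$ be the indicator vector of $I$ and $$C_I(c)=\{e\in\mathbb R^N: e_i>-c_i\ (i\in I),\ e_i\le -c_i\ (i\notin I)\}.$$ Given a process $X'=(X'_t)_{t\in\mathbb Z}$ with the law of $X$ on some probability space $(\Omega,P)$, a *stationary solution* is a pair of $\mathbb R^N$-valued processes $(Y_t)_{t\in\mathbb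 Z}$, $(\mu_t)_{t\in\mathbb Z}$ on $(\Omega,P)$ such that $((Y_t,\mu_t))_{t\in\mathbb Z}$ is stationary and, for all $t\in\mathbb Z$, almost surely, $$\mu_t=\sum_{j=1}^qB_j\mu_{t-j}+\sum_{k=1}^pA_kY_{t-k}+\Gamma X'_t,$$ $$P\bigl(Y_t=\mathbf 1_I\mid (Y_s)_{s<t},\,(X'_s)_{s\in\mathbb Z}\bigr)=\nu\bigl(C_I(\mu_t)\bigr)\qquad\text{for all } I\subset\{1,\dots,N\}.$$ Then: 1. (Existence) On some enlargement $(\Omega,P)$ of $(\Omega_0,P_0)$, that is, a probability space with a measure-preserving map $\pi:\Omega\to\Omega_0$, there is a stationary solution $(Y,\mu)$ for the covariate process $X_t\circ\pi$. Moreover $(\Omega,P)$ carries an i.i.d. sequence $(\varepsilon_t)_{t\in\mathbb Z}$ with distribution $\nu$, independent of the process $(X_t\circ\pi)_{t\in\mathbb Z}$, such that for all $t\in\mathbb Z$, almost surely, $Y_t=\bigl(\mathbf 1_{\{\mu_{i,t}+\varepsilon_{i,t}>0\}}\bigr)_{1\le i\le N}$. 2. (Uniqueness) Any two stationary solutions,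 possibly on different probability spaces and for covariate processes with the law of $X$, have the same law: the process $((Y_t,\mu_t,X'_t))_{t\in\mathbb Z}$ has the same law for both. 3. For every stationary solution the process $((Y_t,X'_t))_{t\in\mathbb Z}$ is stationary and ergodic. -/

import Mathlib

open MeasureTheory ProbabilityTheory

universe u v w r

namespace DiscreteChoice

/-- The left shift `(x_t) ↦ (x_{t+1})` on two-sided sequences. -/
def shift {α : Type*} (x : ℤ → α) : ℤ → α := fun t => x (t + 1)

/-- The law of a process indexed by `ℤ`, as a measure on the space of two-sided paths (with the
product sigma-algebra). -/
noncomputable def processLaw {Ω α : Type*} [MeasurableSpace Ω] [MeasurableSpace α]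
    (P : Measure Ω) (Z : ℤ → Ω → α) : Measure (ℤ → α) :=
  P.map (fun ω t => Z t ω)

/-- Strict stationarity: the law of the process is invariant under the shift. -/
def IsStationary {Ω α : Type*} [MeasurableSpace Ω] [MeasurableSpace α]
    (P : Measure Ω) (Z : ℤ → Ω → α) : Prop :=
  MeasurePreserving shift (processLaw P Z) (processLaw P Z)

/-- Ergodicity of a (stationary) process: the shift is ergodic for the law of the process. -/
def IsErgodic {Ω α : Type*} [MeasurableSpace Ω] [MeasurableSpace α]
    (P : Measure Ω) (Z : ℤ → Ω → α) : Prop :=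
  Ergodic shift (processLaw P Z)

/-- The joint cumulative distribution function of a probability measure on `ℝ^N`
(`Set.Iic x` is the orthant of all `e` with `e i ≤ x i` for every `i`). -/
noncomputable def jointCdf {N : ℕ} (ν : Measure (Fin N → ℝ)) (x : Fin N → ℝ) : ℝ :=
  ν.real (Set.Iic x)

/-- The vector `1_I` of `ℝ^N`: coordinate `i` is `1` if `i ∈ I` and `0` otherwise. -/
noncomputable def indicatorVec {N : ℕ} (I : Set (Fin N)) : Fin N → ℝ :=
  I.indicator (fun _ => 1)

/-- The set of noise values `e` with `e i > - c i` for `i ∈ I` and `e i ≤ - c i` for `i ∉ I`. -/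
def cell {N : ℕ} (I : Set (Fin N)) (c : Fin N → ℝ) : Set (Fin N → ℝ) :=
  {e | (∀ i ∈ I, - c i < e i) ∧ (∀ i ∉ I, e i ≤ - c i)}

/-- The sigma-algebra generated by `Y_s`, `s < t`, and by the whole covariate process `X`. -/
abbrev pastAndCovariates {Ω α β : Type*} [mα : MeasurableSpace α] [mβ : MeasurableSpace β]
    (Y : ℤ → Ω → α) (X : ℤ → Ω → β) (t : ℤ) : MeasurableSpace Ω :=
  (⨆ s : Set.Iio t, mα.comap (Y s)) ⊔ (⨆ s : ℤ, mβ.comap (X s))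

/-- The roots in `ℂ` of `z ↦ det (I - ∑ j, B_j z^j)` are outside the closed unit disc.
The index `j : Fin q` stands for the lag `j + 1`. -/
def RootsOutsideUnitDisc {N q : ℕ} (B : Fin q → Matrix (Fin N) (Fin N) ℝ) : Prop :=
  ∀ z : ℂ, (1 - ∑ j : Fin q, z ^ ((j : ℕ) + 1) • (B j).map Complex.ofReal).det = 0 → 1 < ‖z‖

/-- `(Y, μ)` is a stationary solution of the discrete choice model with covariate process `X`,
noise distribution `ν`, autoregressive matrices `B_1, …, B_q`, response matrices `A_1, …, A_p`
and covariate matrix `Γ` (`B j`, `A k` with `j : Fin q`, `k : Fin p` belong to the lags `j + 1`,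
`k + 1`), on the probability space `(Ω, P)`. -/
structure IsStationarySolution {N d p q : ℕ} {Ω : Type*} [MeasurableSpace Ω]
    (ν : Measure (Fin N → ℝ))
    (B : Fin q → Matrix (Fin N) (Fin N) ℝ) (A : Fin p → Matrix (Fin N) (Fin N) ℝ)
    (Γ : Matrix (Fin N) (Fin d) ℝ) (P : Measure Ω)
    (X : ℤ → Ω → (Fin d → ℝ)) (Y μ : ℤ → Ω → (Fin N → ℝ)) : Prop where
  measurable_X : ∀ t, Measurable (X t)
  measurable_Y : ∀ t, Measurable (Y t)
  measurable_μ : ∀ t, Measurable (μ t)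
  /-- The latent recursion. -/
  recursion : ∀ t : ℤ, ∀ᵐ ω ∂P,
    μ t ω = ∑ j : Fin q, (B j).mulVec (μ (t - ((j : ℕ) + 1)) ω)
      + ∑ k : Fin p, (A k).mulVec (Y (t - ((k : ℕ) + 1)) ω)
      + Γ.mulVec (X t ω)
  /-- The conditional law of `Y_t` given the past of `Y` and the whole process `X`. -/
  condLaw : ∀ (t : ℤ) (I : Set (Fin N)),
    P⟦Y t ⁻¹' {indicatorVec I} | pastAndCovariates Y X t⟧
      =ᵐ[P] fun ω => ν.real (cell I (μ t ω))
  /-- The solution process is stationary. -/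
  stationary : IsStationary P (fun t ω => (Y t ω, μ t ω))

/-- `ε` is an i.i.d. noise with distribution `ν`, independent of the process `X`, which generates
the responses: `Y_{i,t} = 1` if `μ_{i,t} + ε_{i,t} > 0` and `Y_{i,t} = 0` otherwise. -/
structure IsGeneratedByNoise {N d : ℕ} {Ω : Type*} [MeasurableSpace Ω]
    (ν : Measure (Fin N → ℝ)) (P : Measure Ω)
    (X : ℤ → Ω → (Fin d → ℝ)) (Y μ ε : ℤ → Ω → (Fin N → ℝ)) : Prop where
  measurable_ε : ∀ t, Measurable (ε t)
  law_ε : ∀ t, P.map (ε t) = ν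
  iIndep_ε : iIndepFun ε P
  indep_X : IndepFun (fun ω t => ε t ω) (fun ω t => X t ω) P
  choice : ∀ t : ℤ, ∀ᵐ ω ∂P, Y t ω = indicatorVec {i | 0 < μ t ω i + ε t ω i}

end DiscreteChoice

/-!
The supports of the responses determine them, so a solution is a process of subsets `Y_t` driven by
the noise: `Y_t` is a function of the covariates, of the earlier choices and of `ε_t`. By stability
`μ_t` forgets the choices of the distant past exponentially fast, and since the distribution
function of `ν` is Lipschitz, the choices made more than `l` steps ago change `Y_t` with a
probability which is summable in `l`. As `ν` has full support, it has positive probability that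
from some time on the choices do not depend at all on what happened before that time, and by
ergodicity such regeneration times occur at arbitrarily negative times. From a regeneration time on
the choices are computed from the covariates and the noise alone, which gives a solution as a factor
of the ergodic process `(X_t, ε_t)`. Conversely, in any stationary solution `μ` is the stationary
filter of its input, so the conditional law of `Y_t` is that of the response to fresh noise.
Rerunning the solution from time `-m` on with i.i.d. noise therefore does not change its law, and as
`m → ∞` this rerun coincides near any given time with the constructed solution.
-/

namespace DiscreteChoice

open Filter
open scoped ENNReal Topology

section Shift

variable {α : Type*}

/-- The shift `(x_t) ↦ (x_{t+s})` of two-sided sequences by `s` steps. -/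
def shiftBy (s : ℤ) (x : ℤ → α) : ℤ → α := fun t => x (t + s)

@[simp] lemma shiftBy_apply (s : ℤ) (x : ℤ → α) (t : ℤ) : shiftBy s x t = x (t + s) := rfl

@[simp] lemma shiftBy_shiftBy (r s : ℤ) (x : ℤ → α) :
    shiftBy r (shiftBy s x) = shiftBy (r + s) x := by
  ext t; simp [add_assoc]

@[simp] lemma shiftBy_zero (x : ℤ → α) : shiftBy 0 x = x := by ext t; simp

lemma shift_iterate (n : ℕ) : (shift : (ℤ → α) → ℤ → α)^[n] = shiftBy (n : ℤ) := by
  induction n with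
  | zero => ext x t; simp
  | succ n ih =>
    rw [Function.iterate_succ', ih]
    ext x t; simp [shift, add_assoc, add_comm (1 : ℤ)]

variable [MeasurableSpace α]

@[fun_prop]
lemma measurable_shiftBy (s : ℤ) : Measurable (shiftBy s : (ℤ → α) → ℤ → α) :=
  measurable_pi_lambda _ fun t => measurable_pi_apply (t + s)

lemma measurePreserving_shiftBy {lam : Measure (ℤ → α)} (h : MeasurePreserving shift lam lam)
    (s : ℤ) : MeasurePreserving (shiftBy s) lam lam := by
  have forward (n : ℕ) : MeasurePreserving (shiftBy (n : ℤ)) lam lam := by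
    rw [← shift_iterate]; exact h.iterate n
  obtain ⟨n, rfl | rfl⟩ := s.eq_nat_or_neg
  · exact forward n
  · refine ⟨measurable_shiftBy _, ?_⟩
    have inverse : shiftBy (-(n : ℤ)) ∘ shiftBy (n : ℤ) = (id : (ℤ → α) → ℤ → α) := by
      ext x t; simp
    conv_lhs => rw [← (forward n).map_eq]
    rw [Measure.map_map (measurable_shiftBy _) (measurable_shiftBy _), inverse, Measure.map_id]

end Shift

section InfiniteProduct

variable {ι : Type*} {X : ι → Type*} [∀ i, MeasurableSpace (X i)]
  (ν : ∀ i, Measure (X i)) [∀ i, IsProbabilityMeasure (ν i)]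

lemma measurePreserving_piecewise_infinitePi (S : Set ι) [DecidablePred (· ∈ S)] :
    MeasurePreserving (fun e : (∀ i, X i) × (∀ i, X i) => S.piecewise e.1 e.2)
      ((Measure.infinitePi ν).prod (Measure.infinitePi ν)) (Measure.infinitePi ν) := by
  have hm : Measurable fun e : (∀ i, X i) × (∀ i, X i) => S.piecewise e.1 e.2 := by
    refine measurable_pi_lambda _ fun i => ?_
    unfold Set.piecewise
    split_ifs <;> fun_prop
  refine ⟨hm, Measure.eq_infinitePi _ fun s t ht => ?_⟩
  have preimage_box : (fun e : (∀ i, X i) × (∀ i, X i) => S.piecewise e.1 e.2) ⁻¹' Set.pi s t =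
      Set.pi (s.filter (· ∈ S) : Finset ι) t ×ˢ Set.pi (s.filter (· ∉ S) : Finset ι) t := by
    ext e
    simp only [Set.mem_preimage, Set.mem_pi, SetLike.mem_coe, Set.mem_prod, Finset.mem_filter,
      and_imp, ← forall_and]
    exact forall_congr' fun i => by by_cases hi : i ∈ S <;> simp [hi]
  rw [Measure.map_apply hm (MeasurableSet.pi s.countable_toSet fun i _ => ht i), preimage_box,
    Measure.prod_prod, Measure.infinitePi_pi _ fun i _ => ht i,
    Measure.infinitePi_pi _ fun i _ => ht i, Finset.prod_filter_mul_prod_filter_not]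

lemma measure_inter_of_dependsOn {V W : Set (∀ i, X i)} (hV : MeasurableSet V)
    (hW : MeasurableSet W) {S : Set ι} (hVS : DependsOn (· ∈ V) S) (hWS : DependsOn (· ∈ W) Sᶜ) :
    Measure.infinitePi ν (V ∩ W) = Measure.infinitePi ν V * Measure.infinitePi ν W := by
  classical
  rw [← Measure.prod_prod, ← (measurePreserving_piecewise_infinitePi ν S).measure_preimage
    (hV.inter hW).nullMeasurableSet]
  congr 1
  ext e
  exact and_congr (Eq.to_iff (hVS fun i hi => by simp [hi]))
    (Eq.to_iff (hWS fun i hi => Set.piecewise_eq_of_notMem _ _ _ hi))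

variable [DecidableEq ι]

lemma measurePreserving_update_infinitePi (i : ι) :
    MeasurePreserving (fun p : (∀ j, X j) × X i => Function.update p.1 i p.2)
      ((Measure.infinitePi ν).prod (ν i)) (Measure.infinitePi ν) := by
  have hm : Measurable fun p : (∀ j, X j) × X i => Function.update p.1 i p.2 :=
    measurable_update'
  have heval : MeasurePreserving (fun p : (∀ j, X j) × (∀ j, X j) => (p.1, p.2 i))
      ((Measure.infinitePi ν).prod (Measure.infinitePi ν)) ((Measure.infinitePi ν).prod (ν i)) :=
    (MeasurePreserving.id _).prod (measurePreserving_eval_infinitePi ν i)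
  refine ⟨hm, ?_⟩
  rw [← heval.map_eq, Measure.map_map hm heval.measurable]
  refine Eq.trans ?_ (measurePreserving_piecewise_infinitePi ν ({i}ᶜ : Set ι)).map_eq
  congr 1
  ext p j
  rcases eq_or_ne j i with rfl | hj <;> simp [*]

lemma measurePreserving_resample {Ω : Type*} [MeasurableSpace Ω] (P : Measure Ω) [SFinite P]
    (i : ι) :
    MeasurePreserving
      (fun p : (Ω × (∀ j, X j)) × X i => (p.1.1, Function.update p.1.2 i p.2))
      ((P.prod (Measure.infinitePi ν)).prod (ν i)) (P.prod (Measure.infinitePi ν)) :=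
  ((MeasurePreserving.id P).prod (measurePreserving_update_infinitePi ν i)).comp
    (measurePreserving_prodAssoc _ _ _)

lemma measure_inter_eval_mem_eq_setLIntegral {Ω : Type*} [MeasurableSpace Ω] (P : Measure Ω)
    [IsFiniteMeasure P] (i : ι) {G : Set (Ω × (∀ j, X j))} (hG : MeasurableSet G)
    (hG_update : ∀ ω e e₀, (ω, Function.update e i e₀) ∈ G ↔ (ω, e) ∈ G)
    {V : Ω × (∀ j, X j) → Set (X i)}
    (hV : MeasurableSet {p : (Ω × (∀ j, X j)) × X i | p.2 ∈ V p.1})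
    (hV_update : ∀ ω e e₀, V (ω, Function.update e i e₀) = V (ω, e)) :
    P.prod (Measure.infinitePi ν) (G ∩ {ω | ω.2 i ∈ V ω}) =
      ∫⁻ ω in G, ν i (V ω) ∂P.prod (Measure.infinitePi ν) := by
  have heval : Measurable fun ω : Ω × (∀ j, X j) => (ω, ω.2 i) := by fun_prop
  have hmeas : MeasurableSet (G ∩ {ω | ω.2 i ∈ V ω}) := hG.inter (heval hV)
  rw [← (measurePreserving_resample ν P i).measure_preimage hmeas.nullMeasurableSet]
  have preimage_eq : (fun p : (Ω × (∀ j, X j)) × X i => (p.1.1, Function.update p.1.2 i p.2)) ⁻¹'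
      (G ∩ {ω | ω.2 i ∈ V ω}) = (G ×ˢ Set.univ) ∩ {p | p.2 ∈ V p.1} := by
    ext p
    simp [hG_update, hV_update]
  rw [preimage_eq, Measure.prod_apply ((hG.prod .univ).inter hV), ← lintegral_indicator hG]
  refine lintegral_congr fun ω => ?_
  by_cases hω : ω ∈ G <;> simp [hω, Set.preimage]

end InfiniteProduct

section Iid

variable {E : Type*} [MeasurableSpace E]

/-- The law of an i.i.d. sequence indexed by `ℤ` with marginal `ν`. -/
noncomputable abbrev iidLaw (ν : Measure E) : Measure (ℤ → E) := Measure.infinitePi fun _ => ν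

lemma measurePreserving_shiftBy_iidLaw (ν : Measure E) [IsProbabilityMeasure ν] (s : ℤ) :
    MeasurePreserving (shiftBy s) (iidLaw ν) (iidLaw ν) :=
  ⟨measurable_shiftBy s,
    Measure.map_infinitePi_infinitePi_of_inj (P := fun _ => ν) (add_left_injective s)⟩

lemma measurePreserving_shift_iidLaw (ν : Measure E) [IsProbabilityMeasure ν] :
    MeasurePreserving shift (iidLaw ν) (iidLaw ν) :=
  measurePreserving_shiftBy_iidLaw ν 1

end Iid

section LocalSets

variable {γ E : Type*} [MeasurableSpace γ] [MeasurableSpace E]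

/-- The measurable sets of pairs `(x, e)` which depend on finitely many coordinates of the path `e`
(and on the whole of `x`). They form an algebra which generates the σ-algebra. -/
def localSets (γ E : Type*) [MeasurableSpace γ] [MeasurableSpace E] : Set (Set (γ × (ℤ → E))) :=
  {A | MeasurableSet A ∧
    ∃ n : ℕ, ∀ x, DependsOn (fun e : ℤ → E => (x, e) ∈ A) (Set.Icc (-(n : ℤ)) n)}

lemma isSetAlgebra_localSets : IsSetAlgebra (localSets γ E) where
  empty_mem := ⟨.empty, 0, fun _ _ _ _ => rfl⟩
  compl_mem := fun _ ⟨hA, n, hn⟩ => ⟨hA.compl, n, fun x _ _ he => congrArg Not (hn x he)⟩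
  union_mem := by
    rintro A A' ⟨hA, n, hn⟩ ⟨hA', n', hn'⟩
    refine ⟨hA.union hA', max n n', fun x e e' he => congrArg₂ Or (hn x ?_) (hn' x ?_)⟩ <;>
      exact fun t ht => he t (by simp only [Set.mem_Icc, Nat.cast_max] at ht ⊢; omega)

lemma generateFrom_localSets :
    MeasurableSpace.generateFrom (localSets γ E) = Prod.instMeasurableSpace := by
  refine le_antisymm (MeasurableSpace.generateFrom_le fun A hA => hA.1) (sup_le ?_ ?_)
  · rintro _ ⟨B, hB, rfl⟩
    exact MeasurableSpace.measurableSet_generateFrom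
      ⟨measurable_fst hB, 0, fun x e e' _ => rfl⟩
  · rw [MeasurableSpace.comap_le_iff_le_map]
    refine iSup_le fun t => ?_
    rintro _ ⟨B, hB, rfl⟩
    refine MeasurableSpace.measurableSet_generateFrom
      ⟨measurable_snd (measurable_pi_apply t hB), t.natAbs, fun x e e' he => ?_⟩
    simp [he t (by simp [neg_abs_le, le_abs_self])]

end LocalSets

section Sections

variable {γ β : Type*} [MeasurableSpace γ] [MeasurableSpace β] {κ : Measure γ} {ρ : Measure β}

lemma measurable_measureReal_section [SFinite ρ] {A : Set (γ × β)} (hA : MeasurableSet A) :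
    Measurable fun x => ρ.real (Prod.mk x ⁻¹' A) :=
  (measurable_measure_prodMk_left hA).ennreal_toReal

lemma integrable_measureReal_section [IsFiniteMeasure κ] [IsFiniteMeasure ρ] {A : Set (γ × β)}
    (hA : MeasurableSet A) : Integrable (fun x => ρ.real (Prod.mk x ⁻¹' A)) κ :=
  Integrable.of_bound (measurable_measureReal_section hA).aestronglyMeasurable (ρ.real Set.univ)
    (.of_forall fun _ => by
      rw [Real.norm_of_nonneg measureReal_nonneg]; exact measureReal_mono (Set.subset_univ _))

lemma measureReal_prod_eq_integral [IsFiniteMeasure ρ] {A : Set (γ × β)} (hA : MeasurableSet A) :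
    (κ.prod ρ).real A = ∫ x, ρ.real (Prod.mk x ⁻¹' A) ∂κ := by
  rw [measureReal_def, Measure.prod_apply hA]
  exact (integral_toReal (measurable_measure_prodMk_left hA).aemeasurable
    (.of_forall fun x => measure_lt_top _ _)).symm

variable [IsProbabilityMeasure κ] [IsProbabilityMeasure ρ]

lemma ae_measureReal_section_eq {T : γ → γ} {g : β → β} (hT : Ergodic T κ)
    (hg : MeasurePreserving g ρ ρ) {A : Set (γ × β)} (hA : MeasurableSet A)
    (hinv : Prod.map T g ⁻¹' A = A) :
    ∀ᵐ x ∂κ, ρ.real (Prod.mk x ⁻¹' A) = (κ.prod ρ).real A := by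
  have section_comp (x : γ) : ρ.real (Prod.mk (T x) ⁻¹' A) = ρ.real (Prod.mk x ⁻¹' A) := by
    rw [← hg.measureReal_preimage (measurable_prodMk_left hA).nullMeasurableSet]
    conv_rhs => rw [← hinv]
    rfl
  obtain ⟨c, hc⟩ := hT.ae_eq_const_of_ae_eq_comp_ae
    (measurable_measureReal_section hA).aestronglyMeasurable (.of_forall section_comp)
  have hAc : (κ.prod ρ).real A = c := by
    rw [measureReal_prod_eq_integral hA, integral_congr_ae hc]; simp
  filter_upwards [hc] with x hx
  rw [hAc]; exact hx

lemma integral_abs_measureReal_section_sub_le {A A' : Set (γ × β)} (hA : MeasurableSet A)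
    (hA' : MeasurableSet A') {c : ℝ} (hc : ∀ᵐ x ∂κ, ρ.real (Prod.mk x ⁻¹' A) = c) :
    ∫ x, |ρ.real (Prod.mk x ⁻¹' A') - c| ∂κ ≤ (κ.prod ρ).real (symmDiff A A') := by
  rw [measureReal_prod_eq_integral (hA.symmDiff hA')]
  refine integral_mono_ae ((integrable_measureReal_section hA').sub (integrable_const c)).abs
    (integrable_measureReal_section (hA.symmDiff hA')) ?_
  filter_upwards [hc] with x hx
  rw [← hx, abs_sub_comm]
  exact abs_measureReal_sub_le_measureReal_symmDiff
    (measurable_prodMk_left hA).nullMeasurableSet (measurable_prodMk_left hA').nullMeasurableSet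

end Sections

section Ergodicity

lemma abs_integral_mul_comp_sub_sq_le {γ : Type*} [MeasurableSpace γ] {κ : Measure γ}
    [IsProbabilityMeasure κ] {T : γ → γ} (hT : MeasurePreserving T κ κ) {f : γ → ℝ}
    (hf : Measurable f) (hf_mem : ∀ x, f x ∈ Set.Icc 0 1) {c : ℝ} (hc : c ∈ Set.Icc (0 : ℝ) 1) :
    |∫ x, f x * f (T x) ∂κ - c ^ 2| ≤ 2 * ∫ x, |f x - c| ∂κ := by
  have hint : Integrable (fun x => |f x - c|) κ :=
    ((Integrable.of_mem_Icc 0 1 hf.aemeasurable (.of_forall hf_mem)).sub (integrable_const c)).abs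
  have hintT : Integrable (fun x => |f (T x) - c|) κ := hT.integrable_comp_of_integrable hint
  have hint_mul : Integrable (fun x => f x * f (T x)) κ :=
    Integrable.of_mem_Icc 0 1 (hf.mul (hf.comp hT.measurable)).aemeasurable
      (.of_forall fun x => unitInterval.mul_mem (hf_mem x) (hf_mem (T x)))
  have hTint : ∫ x, |f (T x) - c| ∂κ = ∫ x, |f x - c| ∂κ := by
    conv_rhs => rw [← hT.map_eq]
    exact (integral_map hT.aemeasurable (hf.sub_const c).norm.aestronglyMeasurable).symm
  have pointwise (x : γ) : |f x * f (T x) - c ^ 2| ≤ |f x - c| + |f (T x) - c| := by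
    have split : f x * f (T x) - c ^ 2 = (f x - c) * f (T x) + c * (f (T x) - c) := by ring
    rw [split]
    refine (abs_add_le _ _).trans (add_le_add ?_ ?_)
    · rw [abs_mul, abs_of_nonneg (hf_mem _).1]
      exact mul_le_of_le_one_right (abs_nonneg _) (hf_mem _).2
    · rw [abs_mul, abs_of_nonneg hc.1]
      exact mul_le_of_le_one_left (abs_nonneg _) hc.2
  calc |∫ x, f x * f (T x) ∂κ - c ^ 2|
      = |∫ x, (f x * f (T x) - c ^ 2) ∂κ| := by
        rw [integral_sub hint_mul (integrable_const _)]; simp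
    _ ≤ ∫ x, |f x * f (T x) - c ^ 2| ∂κ := abs_integral_le_integral_abs
    _ ≤ ∫ x, (|f x - c| + |f (T x) - c|) ∂κ :=
        integral_mono (hint_mul.sub (integrable_const _)).abs (hint.add hintT) pointwise
    _ = 2 * ∫ x, |f x - c| ∂κ := by rw [integral_add hint hintT, hTint]; ring

lemma abs_measureReal_sub_inter_preimage_le {Ω : Type*} [MeasurableSpace Ω] {Q : Measure Ω}
    [IsFiniteMeasure Q] {S : Ω → Ω} (hS : MeasurePreserving S Q Q) {A A' : Set Ω}
    (hA : MeasurableSet A) (hA' : MeasurableSet A') (hinv : S ⁻¹' A = A) :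
    |Q.real A - Q.real (A' ∩ S ⁻¹' A')| ≤ 2 * Q.real (symmDiff A A') := by
  have hsub : symmDiff A (A' ∩ S ⁻¹' A') ⊆ symmDiff A A' ∪ S ⁻¹' symmDiff A A' := by
    intro ω hω
    have hinvω : S ω ∈ A ↔ ω ∈ A := by conv_rhs => rw [← hinv, Set.mem_preimage]
    simp only [Set.mem_symmDiff, Set.mem_inter_iff, Set.mem_preimage, Set.mem_union] at hω ⊢
    tauto
  calc |Q.real A - Q.real (A' ∩ S ⁻¹' A')|
      ≤ Q.real (symmDiff A (A' ∩ S ⁻¹' A')) := abs_measureReal_sub_le_measureReal_symmDiff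
        hA.nullMeasurableSet (hA'.inter (hS.measurable hA')).nullMeasurableSet
    _ ≤ Q.real (symmDiff A A') + Q.real (S ⁻¹' symmDiff A A') :=
        (measureReal_mono hsub).trans (measureReal_union_le _ _)
    _ = 2 * Q.real (symmDiff A A') := by
        rw [hS.measureReal_preimage (hA.symmDiff hA').nullMeasurableSet]; ring

variable {γ E : Type*} [MeasurableSpace γ] [MeasurableSpace E] {κ : Measure γ}
  (ν : Measure E) [IsProbabilityMeasure ν] {T : γ → γ}

-- Given the first component, the two sets depend on disjoint blocks of the noise.
lemma measureReal_inter_preimage_shiftBy {A : Set (γ × (ℤ → E))} (hA : MeasurableSet A) {n : ℕ}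
    (hn : ∀ x, DependsOn (fun e : ℤ → E => (x, e) ∈ A) (Set.Icc (-(n : ℤ)) n)) (hT : Measurable T) :
    (κ.prod (iidLaw ν)).real (A ∩ Prod.map T (shiftBy (2 * n + 1)) ⁻¹' A) =
      ∫ x, (iidLaw ν).real (Prod.mk x ⁻¹' A) * (iidLaw ν).real (Prod.mk (T x) ⁻¹' A) ∂κ := by
  have hshift := measurePreserving_shiftBy_iidLaw ν (2 * n + 1)
  rw [measureReal_prod_eq_integral (hA.inter (hT.prodMap hshift.measurable hA))]
  refine integral_congr_ae (.of_forall fun x => ?_)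
  have hsec (x : γ) : MeasurableSet (Prod.mk x ⁻¹' A) := measurable_prodMk_left hA
  have hdep : DependsOn (· ∈ shiftBy (2 * n + 1) ⁻¹' (Prod.mk (T x) ⁻¹' A))
      (Set.Icc (-(n : ℤ)) n)ᶜ := fun e e' he => hn (T x) fun t ht => he _ (by
    simp only [Set.mem_compl_iff, Set.mem_Icc] at ht ⊢; omega)
  simp only [measureReal_def, ← ENNReal.toReal_mul]
  rw [← hshift.measure_preimage (hsec (T x)).nullMeasurableSet,
    ← measure_inter_of_dependsOn _ (hsec x) (hshift.measurable (hsec (T x))) (hn x) hdep]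
  rfl

variable [IsProbabilityMeasure κ]

lemma sq_measureReal_eq_of_invariant (hT : Ergodic T κ) {A : Set (γ × (ℤ → E))}
    (hA : MeasurableSet A) (hinv : Prod.map T shift ⁻¹' A = A) :
    (κ.prod (iidLaw ν)).real A = (κ.prod (iidLaw ν)).real A ^ 2 := by
  set Q := κ.prod (iidLaw ν)
  have hS : MeasurePreserving (Prod.map T shift) Q Q :=
    hT.toMeasurePreserving.prod (measurePreserving_shift_iidLaw ν)
  refine eq_of_forall_dist_le fun ε hε => ?_
  obtain ⟨A', ⟨hA', n, hn⟩, hAA'⟩ := (Measure.MeasureDense.of_generateFrom_isSetAlgebra_finite Q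
    isSetAlgebra_localSets generateFrom_localSets.symm).approx A hA (measure_ne_top _ _) (ε / 4)
      (by positivity)
  have hclose : Q.real (symmDiff A A') ≤ ε / 4 :=
    ENNReal.toReal_le_of_le_ofReal (by positivity) hAA'.le
  have hiter : (Prod.map T (shift : (ℤ → E) → ℤ → E))^[2 * n + 1] =
      Prod.map T^[2 * n + 1] (shiftBy (2 * n + 1)) := by
    rw [Prod.map_iterate, shift_iterate]; norm_cast
  have hinv_iter : (Prod.map T shift)^[2 * n + 1] ⁻¹' A = A := by
    rw [Set.preimage_iterate_eq]; exact Function.iterate_fixed hinv _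
  have hAmix := abs_measureReal_sub_inter_preimage_le (hS.iterate (2 * n + 1)) hA hA' hinv_iter
  rw [hiter, measureReal_inter_preimage_shiftBy ν hA' hn (hT.measurable.iterate _)] at hAmix
  have hmix := abs_integral_mul_comp_sub_sq_le (hT.toMeasurePreserving.iterate (2 * n + 1))
    (measurable_measureReal_section (ρ := iidLaw ν) hA')
    (fun x => ⟨measureReal_nonneg, measureReal_le_one⟩)
    (c := Q.real A) ⟨measureReal_nonneg, measureReal_le_one⟩
  have hL1 := integral_abs_measureReal_section_sub_le hA hA'
    (ae_measureReal_section_eq hT (measurePreserving_shift_iidLaw ν) hA hinv)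
  rw [Real.dist_eq]
  refine (abs_sub_le _ _ _).trans ((add_le_add hAmix hmix).trans ?_)
  linarith

theorem ergodic_prodMap_shift (hT : Ergodic T κ) :
    Ergodic (Prod.map T shift) (κ.prod (iidLaw ν)) where
  toMeasurePreserving := hT.toMeasurePreserving.prod (measurePreserving_shift_iidLaw ν)
  aeconst_set A hA hinv := by
    set Q := κ.prod (iidLaw ν)
    have idem : Q.real A * (1 - Q.real A) = 0 := by
      linear_combination sq_measureReal_eq_of_invariant ν hT hA hinv
    rw [Filter.eventuallyConst_set]
    rcases mul_eq_zero.1 idem with h0 | h1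
    · exact .inr (measure_eq_zero_iff_ae_notMem.1 ((measureReal_eq_zero_iff).1 h0))
    · refine .inl ((mem_ae_iff_prob_eq_one hA).2 ((ENNReal.toReal_eq_one_iff _).1 ?_))
      exact (sub_eq_zero.1 h1).symm

end Ergodicity

section Recurrence

variable {Ω : Type*} [MeasurableSpace Ω] {Q : Measure Ω} {T : Ω → Ω}

lemma ergodic_of_leftInverse (hT : Ergodic T Q) {S : Ω → Ω} (hS : Measurable S)
    (hST : Function.LeftInverse S T) : Ergodic S Q where
  measurable := hS
  map_eq := by
    conv_lhs => rw [← hT.map_eq, Measure.map_map hS hT.measurable, hST.comp_eq_id, Measure.map_id]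
  aeconst_set A hA hinv := hT.aeconst_set hA <| by
    conv_lhs => rw [← hinv, ← Set.preimage_comp, hST.comp_eq_id, Set.preimage_id]

lemma ae_frequently_iterate_mem [IsFiniteMeasure Q] (hT : Ergodic T Q) {R : Set Ω}
    (hR : MeasurableSet R) (hpos : Q R ≠ 0) :
    ∀ᵐ ω ∂Q, ∃ᶠ n in Filter.atTop, T^[n] ω ∈ R := by
  set F : Set Ω := {ω | ∃ᶠ n in Filter.atTop, T^[n] ω ∈ R}
  have hF : MeasurableSet F := by
    have : F = Filter.limsup (fun n => T^[n] ⁻¹' R) Filter.atTop := by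
      ext ω; simp [F, Filter.mem_limsup_iff_frequently_mem]
    rw [this]
    exact .measurableSet_limsup fun n => hT.measurable.iterate n hR
  have hFinv : T ⁻¹' F = F := by
    ext ω
    change (∃ᶠ n in Filter.atTop, T^[n + 1] ω ∈ R) ↔ _
    rw [← Filter.frequently_map (m := (· + 1)) (P := fun n => T^[n] ω ∈ R),
      Filter.map_add_atTop_eq_nat]
    rfl
  refine (hT.ae_mem_or_ae_notMem hF hFinv).resolve_right fun hnot => hpos ?_
  rw [measure_eq_zero_iff_ae_notMem]
  filter_upwards [hnot,
    hT.toMeasurePreserving.conservative.ae_mem_imp_frequently_image_mem hR.nullMeasurableSet]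
    with ω hω hrec hωR using hω (hrec hωR)

end Recurrence

section ShiftPair

variable {α E : Type*}

/-- The simultaneous shift of two paths. -/
def shiftPair (s : ℤ) (ω : (ℤ → α) × (ℤ → E)) : (ℤ → α) × (ℤ → E) :=
  (shiftBy s ω.1, shiftBy s ω.2)

@[simp] lemma shiftPair_fst (s : ℤ) (ω : (ℤ → α) × (ℤ → E)) :
    (shiftPair s ω).1 = shiftBy s ω.1 := rfl

@[simp] lemma shiftPair_snd (s : ℤ) (ω : (ℤ → α) × (ℤ → E)) :
    (shiftPair s ω).2 = shiftBy s ω.2 := rfl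

lemma shiftPair_neg_one_iterate (n : ℕ) :
    (shiftPair (-1) : (ℤ → α) × (ℤ → E) → (ℤ → α) × (ℤ → E))^[n] = shiftPair (-n) := by
  induction n with
  | zero => ext ω <;> simp
  | succ n ih =>
    rw [Function.iterate_succ', ih]
    ext ω t <;> simp <;> ring_nf

variable [MeasurableSpace α] [MeasurableSpace E]

@[fun_prop]
lemma measurable_shiftPair (s : ℤ) :
    Measurable (shiftPair s : (ℤ → α) × (ℤ → E) → (ℤ → α) × (ℤ → E)) := by
  unfold shiftPair; fun_prop

variable {lam : Measure (ℤ → α)} [IsProbabilityMeasure lam] (ν : Measure E)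
  [IsProbabilityMeasure ν]

lemma ergodic_shiftPair_one (h : Ergodic shift lam) :
    Ergodic (shiftPair 1) (lam.prod (iidLaw ν)) :=
  ergodic_prodMap_shift ν h

lemma ae_frequently_shiftPair_neg_mem (h : Ergodic shift lam) {R : Set ((ℤ → α) × (ℤ → E))}
    (hR : MeasurableSet R) (hpos : lam.prod (iidLaw ν) R ≠ 0) :
    ∀ᵐ ω ∂lam.prod (iidLaw ν), ∃ᶠ n : ℕ in Filter.atTop, shiftPair (-n) ω ∈ R := by
  have backward : Ergodic (shiftPair (-1)) (lam.prod (iidLaw ν)) :=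
    ergodic_of_leftInverse (ergodic_shiftPair_one ν h) (measurable_shiftPair _)
      fun ω => by ext t <;> simp
  filter_upwards [ae_frequently_iterate_mem backward hR hpos] with ω hω
  simpa only [shiftPair_neg_one_iterate] using hω

end ShiftPair

section Run

variable {α E C : Type*}

/-- The path `z` obeys the response map `Φ` at time `t`: the response `z t` is computed by `Φ` from
the covariates `x` and the responses `z`, both seen from time `t`, and the noise `e t`. -/
def Follows (Φ : (ℤ → α) → (ℤ → C) → E → C) (x : ℤ → α) (e : ℤ → E) (z : ℤ → C) (t : ℤ) : Prop :=
  z t = Φ (shiftBy t x) (shiftBy t z) (e t)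

/-- A response map which only looks at the responses at negative times, that is, at the past. -/
structure IsCausal [MeasurableSpace α] [MeasurableSpace E] [MeasurableSpace C]
    (Φ : (ℤ → α) → (ℤ → C) → E → C) : Prop where
  measurable : Measurable fun q : (ℤ → α) × (ℤ → C) × E => Φ q.1 q.2.1 q.2.2
  dependsOn_past : ∀ x e, DependsOn (fun y => Φ x y e) (Set.Iio 0)

/-- The path which equals `y` before time `a` and is generated by the response map `Φ` from time
`a` on. Future responses are replaced by the default value in order to have a recursion. -/
def run [Inhabited C] (Φ : (ℤ → α) → (ℤ → C) → E → C) (x : ℤ → α) (e : ℤ → E) (y : ℤ → C) (a : ℤ)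
    (t : ℤ) : C :=
  if t < a then y t
  else Φ (shiftBy t x) (fun s => if s < 0 then run Φ x e y a (t + s) else default) (e t)
termination_by (t + 1 - a).toNat

variable {Φ : (ℤ → α) → (ℤ → C) → E → C} {x : ℤ → α} {e e' : ℤ → E} {y z z' : ℤ → C} {a b t : ℤ}

lemma follows_shiftBy (s : ℤ) :
    Follows Φ (shiftBy s x) (shiftBy s e) (shiftBy s z) t ↔ Follows Φ x e z (t + s) := by
  simp [Follows]

variable [MeasurableSpace α] [MeasurableSpace E] [MeasurableSpace C]

lemma IsCausal.eq_of_follows (hΦ : IsCausal Φ) (hinit : ∀ t < a, z t = z' t)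
    (hz : ∀ t ∈ Set.Ico a b, Follows Φ x e z t) (hz' : ∀ t ∈ Set.Ico a b, Follows Φ x e z' t) :
    ∀ t < b, z t = z' t := by
  intro t htb
  induction hn : (t + 1 - a).toNat using Nat.strong_induction_on generalizing t with
  | _ n ih =>
    rcases lt_or_ge t a with hta | hat
    · exact hinit t hta
    · rw [hz t ⟨hat, htb⟩, hz' t ⟨hat, htb⟩]
      refine hΦ.dependsOn_past _ _ fun s hs => ?_
      rw [Set.mem_Iio] at hs
      exact ih _ (by omega) (s + t) (by omega) rfl

variable [Inhabited C]

omit [MeasurableSpace α] [MeasurableSpace E] [MeasurableSpace C] in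
lemma run_of_lt (h : t < a) : run Φ x e y a t = y t := by rw [run, if_pos h]

lemma IsCausal.follows_run (hΦ : IsCausal Φ) (h : a ≤ t) : Follows Φ x e (run Φ x e y a) t := by
  rw [Follows, run, if_neg h.not_gt]
  refine hΦ.dependsOn_past _ _ fun s hs => ?_
  rw [if_pos (Set.mem_Iio.1 hs), shiftBy_apply, add_comm]

lemma IsCausal.run_eq (hΦ : IsCausal Φ) (hinit : ∀ t < a, z t = y t)
    (hz : ∀ t ≥ a, Follows Φ x e z t) : run Φ x e y a = z := by
  ext t
  exact hΦ.eq_of_follows (b := t + 1) (fun t ht => (run_of_lt ht).trans (hinit t ht).symm)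
    (fun t ht => hΦ.follows_run ht.1) (fun t ht => hz t ht.1) t (by omega)

lemma IsCausal.run_shiftBy (hΦ : IsCausal Φ) (s : ℤ) :
    run Φ (shiftBy s x) (shiftBy s e) (shiftBy s y) a = shiftBy s (run Φ x e y (a + s)) :=
  hΦ.run_eq (fun t ht => run_of_lt (by omega))
    fun t ht => (follows_shiftBy s).2 (hΦ.follows_run (by omega))

lemma IsCausal.run_congr_noise (hΦ : IsCausal Φ) (he : ∀ t ∈ Set.Ico a b, e t = e' t)
    (ht : t < b) : run Φ x e y a t = run Φ x e' y a t := by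
  refine hΦ.eq_of_follows (x := x) (e := e') (a := a) (b := b)
    (fun t ht => by rw [run_of_lt ht, run_of_lt ht]) (fun t ht => ?_)
    (fun t ht => hΦ.follows_run ht.1) t ht
  rw [Follows, ← he t ht]
  exact hΦ.follows_run ht.1

lemma IsCausal.measurable_run (hΦ : IsCausal Φ) (a : ℤ) :
    Measurable fun p : (ℤ → α) × (ℤ → E) × (ℤ → C) => run Φ p.1 p.2.1 p.2.2 a := by
  refine measurable_pi_lambda _ fun t => ?_
  induction hn : (t + 1 - a).toNat using Nat.strong_induction_on generalizing t with
  | _ n ih =>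
    rcases lt_or_ge t a with hta | hat
    · simp only [run_of_lt hta]; fun_prop
    · have hpast : Measurable fun p : (ℤ → α) × (ℤ → E) × (ℤ → C) =>
          fun s => if s < 0 then run Φ p.1 p.2.1 p.2.2 a (t + s) else default := by
        refine measurable_pi_lambda _ fun s => ?_
        by_cases hs : s < 0
        · simp only [if_pos hs]; exact ih _ (by omega) _ rfl
        · simp only [if_neg hs]; exact measurable_const
      simp only [run.eq_def (t := t), if_neg hat.not_gt]
      exact hΦ.measurable.comp (((measurable_shiftBy t).comp measurable_fst).prodMk
        (hpast.prodMk (by fun_prop)))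

end Run

section Regeneration

lemma measure_iInter_ne_zero_of_measure_diff_le {Ω : Type*} [MeasurableSpace Ω] {Q : Measure Ω}
    [IsFiniteMeasure Q] {G : ℕ → Set Ω} (hG : Antitone G) (hpos : ∀ n, Q (G n) ≠ 0)
    {β : ℕ → ℝ≥0∞} (hβ : ∑' n, β n ≠ ∞) (hdiff : ∀ n, Q (G n \ G (n + 1)) ≤ β n * Q (G n)) :
    Q (⋂ n, G n) ≠ 0 := by
  intro hzero
  obtain ⟨k, hk⟩ := ((tendsto_order.1 (ENNReal.tendsto_sum_nat_add β hβ)).2 1 one_pos).exists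
  have hcover : G k ⊆ (⋂ n, G n) ∪ ⋃ i, G (i + k) \ G (i + k + 1) := by
    intro ω hω
    by_contra! hnot
    simp only [Set.mem_union, Set.mem_iInter, Set.mem_iUnion, Set.mem_sdiff, not_or, not_exists,
      not_and, not_not] at hnot
    have hlate (i : ℕ) : ω ∈ G (i + k) := by
      induction i with
      | zero => rwa [zero_add]
      | succ i ih => rw [add_right_comm]; exact hnot.2 i ih
    exact hnot.1 fun n => hG (Nat.le_add_right n k) (hlate n)
  refine lt_irrefl (Q (G k)) ?_
  calc Q (G k) ≤ Q (⋂ n, G n) + ∑' i, Q (G (i + k) \ G (i + k + 1)) :=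
        (measure_mono hcover).trans ((measure_union_le _ _).trans
          (add_le_add le_rfl (measure_iUnion_le _)))
    _ ≤ ∑' i, β (i + k) * Q (G k) := by
        rw [hzero, zero_add]
        refine ENNReal.tsum_le_tsum fun i => (hdiff (i + k)).trans ?_
        gcongr
        exact hG (Nat.le_add_left k i)
    _ = (∑' i, β (i + k)) * Q (G k) := ENNReal.tsum_mul_right
    _ < 1 * Q (G k) := ENNReal.mul_lt_mul_left (hpos k) (measure_ne_top _ _) hk
    _ = Q (G k) := one_mul _

variable {α E C : Type*} [MeasurableSpace α] [MeasurableSpace E] [MeasurableSpace C]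

/-- A causal response map `Φ` with a family of sets `U l x y` of noise values at which the response
is determined by the covariates `x` and the last `l` responses `y (-l), …, y (-1)`. The noise `ν`
falls into these sets with positive probability, and it misses them with summable probability. -/
structure IsRegenerative (ν : Measure E) (Φ : (ℤ → α) → (ℤ → C) → E → C)
    (U : ℕ → (ℤ → α) → (ℤ → C) → Set E) (β : ℕ → ℝ≥0∞) : Prop extends IsCausal Φ where
  measurableSet_good : ∀ l, MeasurableSet {q : (ℤ → α) × (ℤ → C) × E | q.2.2 ∈ U l q.1 q.2.1}
  good_dependsOn_past : ∀ l x, DependsOn (fun y => U l x y) (Set.Iio 0)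
  eq_of_mem_good : ∀ {l : ℕ} {x y y' e}, e ∈ U l x y → (∀ s ∈ Set.Ico (-(l : ℤ)) 0, y' s = y s) →
    Φ x y' e = Φ x y e
  measure_good_ne_zero : ∀ l x y, ν (U l x y) ≠ 0
  measure_compl_good_le : ∀ l x y, ν (U l x y)ᶜ ≤ β l
  tsum_ne_top : ∑' l, β l ≠ ∞

variable [Inhabited C]

/-- Time `a` is a regeneration time if the noise at every time `a + n`, `n ≥ 0`, is good for the
last `n` responses of the run started at time `a`. From time `a` on, the responses do then not
depend on what happened before. -/
def IsRegenerationTime (Φ : (ℤ → α) → (ℤ → C) → E → C) (U : ℕ → (ℤ → α) → (ℤ → C) → Set E)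
    (ω : (ℤ → α) × (ℤ → E)) (a : ℤ) : Prop :=
  ∀ n : ℕ, ω.2 (a + n) ∈
    U n (shiftBy (a + n) ω.1) (shiftBy (a + n) (run Φ ω.1 ω.2 default a))

/-- The first `n` conditions for time `0` to be a regeneration time. -/
def regenerationUntil (Φ : (ℤ → α) → (ℤ → C) → E → C) (U : ℕ → (ℤ → α) → (ℤ → C) → Set E)
    (n : ℕ) : Set ((ℤ → α) × (ℤ → E)) :=
  {ω | ∀ k < n, ω.2 k ∈ U k (shiftBy k ω.1) (shiftBy k (run Φ ω.1 ω.2 default 0))}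

omit [MeasurableSpace α] [MeasurableSpace E] [MeasurableSpace C] in
lemma regenerationUntil_succ (Φ : (ℤ → α) → (ℤ → C) → E → C)
    (U : ℕ → (ℤ → α) → (ℤ → C) → Set E) (n : ℕ) :
    regenerationUntil Φ U (n + 1) = regenerationUntil Φ U n ∩
      {ω | ω.2 n ∈ U n (shiftBy n ω.1) (shiftBy n (run Φ ω.1 ω.2 default 0))} := by
  ext ω
  simp only [regenerationUntil, Nat.lt_succ_iff_lt_or_eq, or_imp, forall_and, forall_eq,
    Set.mem_ofPred_eq, Set.mem_inter_iff]

variable {ν : Measure E} {Φ : (ℤ → α) → (ℤ → C) → E → C} {U : ℕ → (ℤ → α) → (ℤ → C) → Set E}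
  {β : ℕ → ℝ≥0∞}

lemma IsRegenerative.isRegenerationTime_shiftPair (h : IsRegenerative ν Φ U β)
    (ω : (ℤ → α) × (ℤ → E)) (s : ℤ) :
    IsRegenerationTime Φ U (shiftPair s ω) 0 ↔ IsRegenerationTime Φ U ω s := by
  have hrun : run Φ (shiftBy s ω.1) (shiftBy s ω.2) default 0 =
      shiftBy s (run Φ ω.1 ω.2 default s) := by
    have := h.run_shiftBy (x := ω.1) (e := ω.2) (y := default) (a := 0) s
    rw [zero_add] at this
    exact this
  simp only [IsRegenerationTime, shiftPair_fst, shiftPair_snd, shiftBy_apply, shiftBy_shiftBy,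
    hrun, zero_add, add_comm s]

lemma IsRegenerative.measurableSet_mem_good (h : IsRegenerative ν Φ U β) (a : ℤ) (l : ℕ) :
    MeasurableSet {p : ((ℤ → α) × (ℤ → E)) × E |
      p.2 ∈ U l (shiftBy a p.1.1) (shiftBy a (run Φ p.1.1 p.1.2 default 0))} := by
  have hrun : Measurable fun ω : (ℤ → α) × (ℤ → E) => run Φ ω.1 ω.2 default 0 :=
    (h.measurable_run 0).comp (measurable_fst.prodMk (measurable_snd.prodMk measurable_const))
  exact (h.measurableSet_good l).preimage (((measurable_shiftBy a).comp
    (measurable_fst.comp measurable_fst)).prodMk (((measurable_shiftBy a).comp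
      (hrun.comp measurable_fst)).prodMk measurable_snd))

lemma IsRegenerative.measurableSet_regenerationUntil (h : IsRegenerative ν Φ U β) (n : ℕ) :
    MeasurableSet (regenerationUntil Φ U n) := by
  simp only [regenerationUntil, Set.ofPred_forall]
  exact .iInter fun k => .iInter fun _ => (h.measurableSet_mem_good k k).preimage
    (measurable_id.prodMk (by fun_prop : Measurable fun ω : (ℤ → α) × (ℤ → E) => ω.2 k))

lemma IsRegenerative.good_update (h : IsRegenerative ν Φ U β) {n l : ℕ} (hl : l ≤ n) (x : ℤ → α)
    (e : ℤ → E) (e₀ : E) :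
    U l (shiftBy l x) (shiftBy l (run Φ x (Function.update e n e₀) default 0)) =
      U l (shiftBy l x) (shiftBy l (run Φ x e default 0)) := by
  refine h.good_dependsOn_past l _ fun s hs => h.run_congr_noise (b := n) (fun t ht => ?_) ?_
  · exact Function.update_of_ne ht.2.ne _ _
  · rw [Set.mem_Iio] at hs; omega

lemma IsRegenerative.update_mem_regenerationUntil (h : IsRegenerative ν Φ U β) (n : ℕ)
    (x : ℤ → α) (e : ℤ → E) (e₀ : E) :
    (x, Function.update e n e₀) ∈ regenerationUntil Φ U n ↔ (x, e) ∈ regenerationUntil Φ U n := by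
  refine forall₂_congr fun k hk => ?_
  simp only [h.good_update hk.le, Function.update_of_ne (Nat.cast_injective.ne hk.ne)]

variable {lam : Measure (ℤ → α)} [IsProbabilityMeasure lam] [IsProbabilityMeasure ν]

lemma IsRegenerative.measure_regenerationUntil_diff_le (h : IsRegenerative ν Φ U β) (n : ℕ) :
    lam.prod (iidLaw ν) (regenerationUntil Φ U n \ regenerationUntil Φ U (n + 1)) ≤
      β n * lam.prod (iidLaw ν) (regenerationUntil Φ U n) := by
  have hcompl := measure_inter_eval_mem_eq_setLIntegral (fun _ : ℤ => ν) lam n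
    (h.measurableSet_regenerationUntil n) (h.update_mem_regenerationUntil n)
    (V := fun ω => (U n (shiftBy n ω.1) (shiftBy n (run Φ ω.1 ω.2 default 0)))ᶜ)
    (h.measurableSet_mem_good n n).compl fun x e e₀ => by rw [h.good_update le_rfl]
  rw [regenerationUntil_succ, Set.sdiff_self_inter]
  refine (le_of_eq hcompl).trans ?_
  rw [← setLIntegral_const]
  exact lintegral_mono fun ω => h.measure_compl_good_le n _ _

lemma IsRegenerative.measure_regenerationUntil_ne_zero (h : IsRegenerative ν Φ U β) (n : ℕ) :
    lam.prod (iidLaw ν) (regenerationUntil Φ U n) ≠ 0 := by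
  induction n with
  | zero => simp [regenerationUntil]
  | succ n ih =>
    rw [regenerationUntil_succ, measure_inter_eval_mem_eq_setLIntegral (fun _ : ℤ => ν) lam n
      (h.measurableSet_regenerationUntil n) (h.update_mem_regenerationUntil n)
      (V := fun ω => U n (shiftBy n ω.1) (shiftBy n (run Φ ω.1 ω.2 default 0)))
      (h.measurableSet_mem_good n n) fun x e e₀ => by rw [h.good_update le_rfl]]
    intro hzero
    have hnull := (setLIntegral_eq_zero_iff (h.measurableSet_regenerationUntil n)
      (measurable_measure_prodMk_left (h.measurableSet_mem_good n n))).1 hzero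
    refine ih (measure_eq_zero_iff_ae_notMem.2 ?_)
    filter_upwards [hnull] with ω hω hmem
    exact h.measure_good_ne_zero n (shiftBy n ω.1) (shiftBy n (run Φ ω.1 ω.2 default 0)) (hω hmem)

omit [IsProbabilityMeasure ν] [MeasurableSpace α] [MeasurableSpace E] [MeasurableSpace C] in
lemma iInter_regenerationUntil :
    ⋂ n, regenerationUntil Φ U n = {ω | IsRegenerationTime Φ U ω 0} := by
  ext ω
  simp only [regenerationUntil, IsRegenerationTime, Set.mem_iInter, Set.mem_ofPred_eq, zero_add]
  exact ⟨fun hω n => hω (n + 1) n n.lt_succ_self, fun hω n k _ => hω k⟩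

theorem IsRegenerative.ae_exists_isRegenerationTime (h : IsRegenerative ν Φ U β)
    (hlam : Ergodic shift lam) :
    ∀ᵐ ω ∂lam.prod (iidLaw ν), ∀ t, ∃ a ≤ t, IsRegenerationTime Φ U ω a := by
  have hpos := measure_iInter_ne_zero_of_measure_diff_le
    (antitone_nat_of_succ_le fun n => by
      rw [regenerationUntil_succ]; exact Set.inter_subset_left)
    (h.measure_regenerationUntil_ne_zero (lam := lam)) h.tsum_ne_top
    h.measure_regenerationUntil_diff_le
  have hrec := ae_frequently_shiftPair_neg_mem ν hlam
    (MeasurableSet.iInter h.measurableSet_regenerationUntil) hpos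
  filter_upwards [hrec] with ω hω t
  obtain ⟨n, hn, hreg⟩ := frequently_atTop.1 hω (-t).toNat
  rw [iInter_regenerationUntil] at hreg
  exact ⟨-n, by omega, (h.isRegenerationTime_shiftPair ω _).1 hreg⟩

end Regeneration

section LimitPath

open Classical in
/-- The value which the sequence `u` eventually takes, or a default value if there is none. -/
noncomputable def eventualValue {C : Type*} [Inhabited C] (u : ℕ → C) : C :=
  if h : ∃ c, ∀ᶠ m in atTop, u m = c then h.choose else default

lemma eventualValue_eq {C : Type*} [Inhabited C] {u : ℕ → C} {c : C}
    (h : ∀ᶠ m in atTop, u m = c) : eventualValue u = c := by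
  have hex : ∃ c, ∀ᶠ m in atTop, u m = c := ⟨c, h⟩
  rw [eventualValue, dif_pos hex]
  obtain ⟨m, hm, hm'⟩ := (hex.choose_spec.and h).exists
  exact hm.symm.trans hm'

lemma measurable_eventualValue {C : Type*} [Inhabited C] [Countable C] [MeasurableSpace C]
    [MeasurableSingletonClass C] : Measurable (eventualValue : (ℕ → C) → C) := by
  have measurableSet_eventually (c : C) :
      MeasurableSet {u : ℕ → C | ∀ᶠ m in atTop, u m = c} := by
    simp only [eventually_atTop, Set.ofPred_exists, Set.ofPred_forall]
    exact .iUnion fun m => .iInter fun k => .iInter fun _ =>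
      (measurableSet_singleton c).preimage (measurable_pi_apply k)
  refine measurable_to_countable' fun c => ?_
  have preimage_eq : eventualValue ⁻¹' {c} = {u : ℕ → C | ∀ᶠ m in atTop, u m = c} ∪
      ((⋂ c', {u : ℕ → C | ∀ᶠ m in atTop, u m = c'}ᶜ) ∩ {_u | default = c}) := by
    ext u
    by_cases h : ∃ c', ∀ᶠ m in atTop, u m = c'
    · obtain ⟨c', hc'⟩ := h
      simp only [Set.mem_preimage, eventualValue_eq hc', Set.mem_singleton_iff, Set.mem_union,
        Set.mem_inter_iff, Set.mem_iInter, Set.mem_compl_iff, Set.mem_ofPred_eq]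
      refine ⟨fun hc => .inl (hc ▸ hc'), ?_⟩
      rintro (hc | ⟨hnot, -⟩)
      · exact (eventualValue_eq hc').symm.trans (eventualValue_eq hc)
      · exact absurd hc' (hnot c')
    · simp only [Set.mem_preimage, eventualValue, dif_neg h, Set.mem_singleton_iff, Set.mem_union,
        Set.mem_inter_iff, Set.mem_iInter, Set.mem_compl_iff, Set.mem_ofPred_eq]
      exact ⟨fun hc => .inr ⟨not_exists.1 h, hc⟩, fun hc => hc.elim (absurd ⟨c, ·⟩ h) And.right⟩
  rw [preimage_eq]
  exact (measurableSet_eventually c).union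
    ((MeasurableSet.iInter fun c' => (measurableSet_eventually c').compl).inter (.const _))

variable {α E C : Type*} [Inhabited C]

/-- The responses generated by `Φ` from the infinite past: at time `t` the eventual value of the
runs started at times tending to `-∞`. -/
noncomputable def limitPath (Φ : (ℤ → α) → (ℤ → C) → E → C) (ω : (ℤ → α) × (ℤ → E)) (t : ℤ) : C :=
  eventualValue fun m : ℕ => run Φ ω.1 ω.2 default (t - m) t

variable [MeasurableSpace α] [MeasurableSpace E] [MeasurableSpace C] {ν : Measure E}
  {Φ : (ℤ → α) → (ℤ → C) → E → C} {U : ℕ → (ℤ → α) → (ℤ → C) → Set E} {β : ℕ → ℝ≥0∞}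
  {ω : (ℤ → α) × (ℤ → E)} {y z : ℤ → C} {a b t : ℤ}

lemma IsCausal.limitPath_shiftPair (hΦ : IsCausal Φ) (s : ℤ) (ω : (ℤ → α) × (ℤ → E)) :
    limitPath Φ (shiftPair s ω) = shiftBy s (limitPath Φ ω) := by
  ext t
  refine congrArg eventualValue (funext fun m => ?_)
  rw [show t + s - (m : ℤ) = t - m + s by ring]
  exact congrFun (hΦ.run_shiftBy (y := default) s) t

lemma IsCausal.limitPath_congr_noise (hΦ : IsCausal Φ) {x : ℤ → α} {e e' : ℤ → E}
    (he : ∀ s ≤ t, e s = e' s) : limitPath Φ (x, e) t = limitPath Φ (x, e') t :=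
  congrArg eventualValue (funext fun _ => hΦ.run_congr_noise (b := t + 1)
    (fun s hs => he s (Int.lt_add_one_iff.1 hs.2)) (lt_add_one t))

lemma IsCausal.measurable_limitPath [Countable C] [MeasurableSingletonClass C]
    (hΦ : IsCausal Φ) : Measurable (limitPath Φ) := by
  refine measurable_pi_lambda _ fun t => measurable_eventualValue.comp ?_
  refine measurable_pi_lambda _ fun m => (measurable_pi_apply t).comp ?_
  exact (hΦ.measurable_run _).comp
    (measurable_fst.prodMk (measurable_snd.prodMk measurable_const))

lemma IsRegenerative.response_eq (h : IsRegenerative ν Φ U β) (ha : IsRegenerationTime Φ U ω a)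
    (hat : a ≤ t) (hz : ∀ s ∈ Set.Ico a t, z s = run Φ ω.1 ω.2 default a s) :
    Φ (shiftBy t ω.1) (shiftBy t z) (ω.2 t) = run Φ ω.1 ω.2 default a t := by
  obtain ⟨n, rfl⟩ := Int.le.dest hat
  rw [h.follows_run hat]
  refine h.eq_of_mem_good (ha n) fun s hs => hz _ ?_
  rw [Set.mem_Ico] at hs ⊢
  omega

lemma IsRegenerative.eq_run_of_follows (h : IsRegenerative ν Φ U β)
    (ha : IsRegenerationTime Φ U ω a) (hz : ∀ t ∈ Set.Ico a b, Follows Φ ω.1 ω.2 z t) :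
    ∀ t ∈ Set.Ico a b, z t = run Φ ω.1 ω.2 default a t := by
  intro t ht
  induction hn : (t - a).toNat using Nat.strong_induction_on generalizing t with
  | _ n ih =>
    rw [hz t ht]
    refine h.response_eq ha ht.1 fun s hs => ih _ ?_ s ⟨hs.1, hs.2.trans ht.2⟩ rfl
    rw [Set.mem_Ico] at hs
    omega

lemma IsRegenerative.limitPath_eq (h : IsRegenerative ν Φ U β) (ha : IsRegenerationTime Φ U ω a)
    (hat : a ≤ t) : limitPath Φ ω t = run Φ ω.1 ω.2 default a t := by
  refine eventualValue_eq ((eventually_ge_atTop (t - a).toNat).mono fun m hm => ?_)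
  exact h.eq_run_of_follows ha (b := t + 1) (fun s hs => h.follows_run (by
    rw [Set.mem_Ico] at hs; omega)) t ⟨hat, lt_add_one t⟩

lemma IsRegenerative.run_eq_limitPath (h : IsRegenerative ν Φ U β)
    (ha : IsRegenerationTime Φ U ω a) (hba : b ≤ a) (hat : a ≤ t) :
    run Φ ω.1 ω.2 y b t = limitPath Φ ω t := by
  rw [h.limitPath_eq ha hat]
  exact h.eq_run_of_follows ha (b := t + 1) (fun s hs => h.follows_run (hba.trans hs.1)) t
    ⟨hat, lt_add_one t⟩

lemma IsRegenerative.follows_limitPath (h : IsRegenerative ν Φ U β)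
    (ha : IsRegenerationTime Φ U ω a) (hat : a ≤ t) :
    Follows Φ ω.1 ω.2 (limitPath Φ ω) t := by
  rw [Follows, h.response_eq ha hat fun s hs => h.limitPath_eq ha hs.1, h.limitPath_eq ha hat]

variable [IsProbabilityMeasure ν] {lam : Measure (ℤ → α)} [IsProbabilityMeasure lam]

lemma IsRegenerative.ae_follows_limitPath (h : IsRegenerative ν Φ U β)
    (hlam : Ergodic shift lam) :
    ∀ᵐ ω ∂lam.prod (iidLaw ν), ∀ t, Follows Φ ω.1 ω.2 (limitPath Φ ω) t := by
  filter_upwards [h.ae_exists_isRegenerationTime hlam] with ω hω t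
  obtain ⟨a, hat, ha⟩ := hω t
  exact h.follows_limitPath ha hat

/-- The joint law of the covariates and of the responses which they generate from the infinite
past, driven by i.i.d. noise with distribution `ν`. -/
noncomputable def limitLaw (lam : Measure (ℤ → α)) (ν : Measure E)
    (Φ : (ℤ → α) → (ℤ → C) → E → C) : Measure ((ℤ → α) × (ℤ → C)) :=
  (lam.prod (iidLaw ν)).map fun ω => (ω.1, limitPath Φ ω)

variable [Countable C] [MeasurableSingletonClass C]

lemma IsCausal.ergodic_limitLaw (hΦ : IsCausal Φ) (hlam : Ergodic shift lam) :
    Ergodic (shiftPair 1) (limitLaw lam ν Φ) := by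
  have hmeas : Measurable fun ω : (ℤ → α) × (ℤ → E) => (ω.1, limitPath Φ ω) :=
    measurable_fst.prodMk hΦ.measurable_limitPath
  refine (hmeas.measurePreserving _).ergodic_of_ergodic_semiconj
    (ergodic_shiftPair_one ν hlam) (measurable_shiftPair 1) fun ω => ?_
  exact Prod.ext rfl (hΦ.limitPath_shiftPair 1 ω)

end LimitPath

lemma measure_eq_tsum_inter_fiber {Ω C : Type*} [MeasurableSpace Ω]
    [MeasurableSpace C] [Countable C] [MeasurableSingletonClass C] (Q : Measure Ω) {f : Ω → C}
    (hf : Measurable f) {A : Set Ω} (hA : MeasurableSet A) :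
    Q A = ∑' c, Q (A ∩ {ω | f ω = c}) := by
  rw [← measure_iUnion (f := fun c => A ∩ {ω | f ω = c})
      (fun c c' hc => Set.disjoint_left.2 fun ω hω hω' => hc (hω.2.symm.trans hω'.2))
      fun c => hA.inter (hf (measurableSet_singleton c)),
    ← Set.inter_iUnion, Set.iUnion_eq_univ_iff.2 fun ω => ⟨f ω, rfl⟩, Set.inter_univ]

section ResponseLaw

variable {α E C : Type*} [Inhabited C]

/-- The pair `(x, y)` of covariates and responses with the responses from time `t` on erased, that
is, replaced by a default value. -/
def eraseFrom (t : ℤ) (p : (ℤ → α) × (ℤ → C)) : (ℤ → α) × (ℤ → C) :=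
  (p.1, fun s => if s < t then p.2 s else default)

lemma eraseFrom_eq_iff {t : ℤ} {x : ℤ → α} {y z : ℤ → C} :
    eraseFrom t (x, y) = eraseFrom t (x, z) ↔ ∀ s < t, y s = z s := by
  simp only [eraseFrom, Prod.mk.injEq, true_and, funext_iff]
  exact forall_congr' fun s => by split_ifs with hs <;> simp [hs]

lemma eraseFrom_idem (t : ℤ) (p : (ℤ → α) × (ℤ → C)) :
    eraseFrom t (eraseFrom t p) = eraseFrom t p :=
  eraseFrom_eq_iff.2 fun _ hs => if_pos hs

variable [MeasurableSpace α] [MeasurableSpace E] [MeasurableSpace C]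

lemma measurable_eraseFrom (t : ℤ) :
    Measurable (eraseFrom t : (ℤ → α) × (ℤ → C) → (ℤ → α) × (ℤ → C)) := by
  refine measurable_fst.prodMk (measurable_pi_lambda _ fun s => ?_)
  split_ifs <;> fun_prop

/-- Under the law `ρ` of covariates and responses, the conditional law of the response at time `t`,
given the covariates and the earlier responses, is the law of `Φ` with noise distribution `ν`. -/
def HasResponseLawAt (ν : Measure E) (Φ : (ℤ → α) → (ℤ → C) → E → C)
    (ρ : Measure ((ℤ → α) × (ℤ → C))) (t : ℤ) : Prop :=
  ∀ G, MeasurableSet G → eraseFrom t ⁻¹' G = G → ∀ c,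
    ρ (G ∩ {p | p.2 t = c}) = ∫⁻ p in G, ν {e | Φ (shiftBy t p.1) (shiftBy t p.2) e = c} ∂ρ

variable {ν : Measure E} {Φ : (ℤ → α) → (ℤ → C) → E → C} {ρ ρ' : Measure ((ℤ → α) × (ℤ → C))}
  {a t : ℤ}

lemma IsCausal.response_eraseFrom (hΦ : IsCausal Φ) (t : ℤ) (p : (ℤ → α) × (ℤ → C)) (e : E) :
    Φ (shiftBy t (eraseFrom t p).1) (shiftBy t (eraseFrom t p).2) e =
      Φ (shiftBy t p.1) (shiftBy t p.2) e :=
  hΦ.dependsOn_past _ e fun s hs => if_pos (by rw [Set.mem_Iio] at hs; omega)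

omit [Inhabited C] in
lemma IsCausal.measurable_response (hΦ : IsCausal Φ) (t : ℤ) :
    Measurable fun p : ((ℤ → α) × (ℤ → C)) × E => Φ (shiftBy t p.1.1) (shiftBy t p.1.2) p.2 :=
  hΦ.measurable.comp (((measurable_shiftBy t).comp (measurable_fst.comp measurable_fst)).prodMk
    (((measurable_shiftBy t).comp (measurable_snd.comp measurable_fst)).prodMk measurable_snd))

variable [MeasurableSingletonClass C]

omit [Inhabited C] in
lemma IsCausal.measurable_measure_response [SFinite ν] (hΦ : IsCausal Φ) (t : ℤ) (c : C) :
    Measurable fun p : (ℤ → α) × (ℤ → C) => ν {e | Φ (shiftBy t p.1) (shiftBy t p.2) e = c} :=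
  measurable_measure_prodMk_left
    ((measurableSet_singleton c).preimage (hΦ.measurable_response t))

lemma HasResponseLawAt.measure_inter_eq [SFinite ν] (hρ : HasResponseLawAt ν Φ ρ t)
    (hΦ : IsCausal Φ) {G : Set ((ℤ → α) × (ℤ → C))} (hG : MeasurableSet G)
    (hGt : eraseFrom t ⁻¹' G = G) (c : C) :
    ρ (G ∩ {p | p.2 t = c}) =
      ∫⁻ p in G, ν {e | Φ (shiftBy t p.1) (shiftBy t p.2) e = c} ∂ρ.map (eraseFrom t) := by
  rw [setLIntegral_map hG (hΦ.measurable_measure_response t c) (measurable_eraseFrom t), hGt,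
    hρ G hG hGt c]
  simp only [hΦ.response_eraseFrom]

variable [IsProbabilityMeasure ν]

lemma IsCausal.hasResponseLawAt_map (hΦ : IsCausal Φ) {Ω : Type*} [MeasurableSpace Ω]
    (P : Measure Ω) [IsProbabilityMeasure P] {F : Ω × (ℤ → E) → (ℤ → α) × (ℤ → C)}
    (hF : Measurable F)
    (hF_update : ∀ ω e e₀, eraseFrom t (F (ω, Function.update e t e₀)) = eraseFrom t (F (ω, e)))
    (hF_follows : ∀ᵐ q ∂P.prod (iidLaw ν), Follows Φ (F q).1 q.2 (F q).2 t) :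
    HasResponseLawAt ν Φ ((P.prod (iidLaw ν)).map F) t := by
  intro G hG hGt c
  have hfiber : MeasurableSet {p : ((ℤ → α) × (ℤ → C)) × E |
      Φ (shiftBy t p.1.1) (shiftBy t p.1.2) p.2 = c} :=
    (measurableSet_singleton c).preimage (hΦ.measurable_response t)
  have hresponse : MeasurableSet {p : (ℤ → α) × (ℤ → C) | p.2 t = c} :=
    (measurableSet_singleton c).preimage (by fun_prop)
  have hnoise : (P.prod (iidLaw ν)) (F ⁻¹' G ∩ F ⁻¹' {p | p.2 t = c}) = (P.prod (iidLaw ν))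
      (F ⁻¹' G ∩ {q | q.2 t ∈ {e | Φ (shiftBy t (F q).1) (shiftBy t (F q).2) e = c}}) := by
    refine measure_congr (EventuallyEq.inter .rfl ?_)
    filter_upwards [hF_follows] with q hq
    exact congrArg (· = c) hq
  rw [Measure.map_apply hF (hG.inter hresponse), Set.preimage_inter,
    hnoise, setLIntegral_map hG (hΦ.measurable_measure_response t c) hF]
  refine measure_inter_eval_mem_eq_setLIntegral (fun _ => ν) P t (hF hG)
    (fun ω e e₀ => ?_)
    (V := fun q => {e | Φ (shiftBy t (F q).1) (shiftBy t (F q).2) e = c})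
    (hfiber.preimage ((hF.comp measurable_fst).prodMk measurable_snd)) fun ω e e₀ => ?_
  · rw [Set.mem_preimage, Set.mem_preimage, ← hGt, Set.mem_preimage, Set.mem_preimage, hF_update]
  · ext e'
    simp only [Set.mem_ofPred_eq]
    rw [← hΦ.response_eraseFrom, hF_update, hΦ.response_eraseFrom]

/-- The joint law of the covariates and of the responses when the responses before time `a` are
taken from the law `ρ` and later ones are generated by `Φ` from i.i.d. noise. -/
noncomputable def runLaw (ν : Measure E) (Φ : (ℤ → α) → (ℤ → C) → E → C)
    (ρ : Measure ((ℤ → α) × (ℤ → C))) (a : ℤ) : Measure ((ℤ → α) × (ℤ → C)) :=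
  (ρ.prod (iidLaw ν)).map fun q => (q.1.1, run Φ q.1.1 q.2 q.1.2 a)

variable [IsProbabilityMeasure ρ]

omit [MeasurableSingletonClass C] [IsProbabilityMeasure ν] [IsProbabilityMeasure ρ] in
lemma IsCausal.measurable_runMap (hΦ : IsCausal Φ) (a : ℤ) :
    Measurable fun q : ((ℤ → α) × (ℤ → C)) × (ℤ → E) => (q.1.1, run Φ q.1.1 q.2 q.1.2 a) :=
  (measurable_fst.comp measurable_fst).prodMk ((hΦ.measurable_run a).comp
    ((measurable_fst.comp measurable_fst).prodMk
      (measurable_snd.prodMk (measurable_snd.comp measurable_fst))))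

lemma IsCausal.hasResponseLawAt_runLaw (hΦ : IsCausal Φ) (hat : a ≤ t) :
    HasResponseLawAt ν Φ (runLaw ν Φ ρ a) t := by
  refine hΦ.hasResponseLawAt_map ρ (hΦ.measurable_runMap a) (fun p e e₀ => ?_)
    (.of_forall fun q => hΦ.follows_run hat)
  exact eraseFrom_eq_iff.2 fun s hs => hΦ.run_congr_noise
    (fun r hr => Function.update_of_ne hr.2.ne _ _) hs

variable [Countable C]

omit [IsProbabilityMeasure ρ] in
lemma HasResponseLawAt.map_eraseFrom_add_one_eq (hΦ : IsCausal Φ)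
    (hρ : HasResponseLawAt ν Φ ρ t) (hρ' : HasResponseLawAt ν Φ ρ' t)
    (heq : ρ.map (eraseFrom t) = ρ'.map (eraseFrom t)) :
    ρ.map (eraseFrom (t + 1)) = ρ'.map (eraseFrom (t + 1)) := by
  ext V hV
  have hresponse : Measurable fun p : (ℤ → α) × (ℤ → C) => p.2 t := by fun_prop
  let G (c : C) : Set ((ℤ → α) × (ℤ → C)) :=
    {p | (p.1, Function.update (eraseFrom t p).2 t c) ∈ V}
  have hG (c : C) : MeasurableSet (G c) :=
    hV.preimage (measurable_fst.prodMk ((measurable_update_left (a := t) (x := c)).comp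
      (measurable_snd.comp (measurable_eraseFrom t))))
  have hGt (c : C) : eraseFrom t ⁻¹' G c = G c := by
    ext p
    simp only [G, Set.mem_preimage, Set.mem_ofPred_eq, eraseFrom_idem]
    rfl
  have hsplit (c : C) : eraseFrom (t + 1) ⁻¹' V ∩ {p | p.2 t = c} = G c ∩ {p | p.2 t = c} := by
    ext p
    refine and_congr_left fun hp : p.2 t = c => Eq.to_iff (congrArg (· ∈ V) (Prod.ext rfl ?_))
    ext s
    rcases lt_trichotomy s t with hs | rfl | hs
    · simp [eraseFrom, hs, hs.ne, hs.le]
    · simp [eraseFrom, hp]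
    · simp [eraseFrom, hs.not_gt, hs.ne', hs.not_ge]
  rw [Measure.map_apply (measurable_eraseFrom _) hV, Measure.map_apply (measurable_eraseFrom _) hV,
    measure_eq_tsum_inter_fiber ρ hresponse (measurable_eraseFrom _ hV),
    measure_eq_tsum_inter_fiber ρ' hresponse (measurable_eraseFrom _ hV)]
  refine tsum_congr fun c => ?_
  rw [hsplit, hρ.measure_inter_eq hΦ (hG c) (hGt c), hρ'.measure_inter_eq hΦ (hG c) (hGt c), heq]

lemma IsCausal.map_eraseFrom_runLaw (hΦ : IsCausal Φ) (hρ : ∀ t, HasResponseLawAt ν Φ ρ t)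
    (n : ℕ) : (runLaw ν Φ ρ a).map (eraseFrom (a + n)) = ρ.map (eraseFrom (a + n)) := by
  induction n with
  | zero =>
    rw [runLaw, Measure.map_map (measurable_eraseFrom _) (hΦ.measurable_runMap a)]
    have hfst : (eraseFrom (a + (0 : ℕ)) ∘ fun q : ((ℤ → α) × (ℤ → C)) × (ℤ → E) =>
        (q.1.1, run Φ q.1.1 q.2 q.1.2 a)) = eraseFrom (a + (0 : ℕ)) ∘ Prod.fst := by
      ext1 q
      exact eraseFrom_eq_iff.2 fun s hs => run_of_lt (by simpa using hs)
    rw [hfst, ← Measure.map_map (measurable_eraseFrom _) measurable_fst,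
      measurePreserving_fst.map_eq]
  | succ n ih =>
    rw [Nat.cast_add_one, ← add_assoc]
    exact (hΦ.hasResponseLawAt_runLaw (by omega)).map_eraseFrom_add_one_eq hΦ (hρ _) ih

variable {U : ℕ → (ℤ → α) → (ℤ → C) → Set E} {β : ℕ → ℝ≥0∞} {lam : Measure (ℤ → α)}
  [IsProbabilityMeasure lam]

lemma IsRegenerative.tendsto_runLaw (h : IsRegenerative ν Φ U β) (hlam : Ergodic shift lam)
    (hfst : MeasurePreserving Prod.fst ρ lam) {V : Set ((ℤ → α) × (ℤ → C))}
    (hV : V ∈ localSets (ℤ → α) C) :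
    Tendsto (fun m : ℕ => runLaw ν Φ ρ (-m) V) atTop (𝓝 (limitLaw lam ν Φ V)) := by
  obtain ⟨hVmeas, n, hn⟩ := hV
  have hproj := hfst.prod (MeasurePreserving.id (iidLaw ν))
  have hlimit : Measurable fun ω : (ℤ → α) × (ℤ → E) => (ω.1, limitPath Φ ω) :=
    measurable_fst.prodMk h.measurable_limitPath
  rw [limitLaw, ← hproj.map_eq, Measure.map_map hlimit hproj.measurable,
    Measure.map_apply (hlimit.comp hproj.measurable) hVmeas]
  simp only [runLaw, Measure.map_apply (h.measurable_runMap _) hVmeas]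
  refine tendsto_measure_of_ae_tendsto_indicator_of_isFiniteMeasure _
    ((hlimit.comp hproj.measurable) hVmeas) (fun m => h.measurable_runMap _ hVmeas) ?_
  filter_upwards [hproj.quasiMeasurePreserving.ae (h.ae_exists_isRegenerationTime hlam)] with q hq
  obtain ⟨a, han, ha⟩ := hq (-n)
  filter_upwards [eventually_ge_atTop (-a).toNat] with m hm
  exact Eq.to_iff (hn q.1.1 fun t ht => h.run_eq_limitPath ha (by omega) (han.trans ht.1))

theorem IsRegenerative.eq_limitLaw (h : IsRegenerative ν Φ U β) (hlam : Ergodic shift lam)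
    (hfst : MeasurePreserving Prod.fst ρ lam) (hρ : ∀ t, HasResponseLawAt ν Φ ρ t) :
    ρ = limitLaw lam ν Φ := by
  have heq : ∀ V ∈ localSets (ℤ → α) C, ρ V = limitLaw lam ν Φ V := by
    intro V hV
    refine tendsto_nhds_unique ?_ (h.tendsto_runLaw hlam hfst hV)
    obtain ⟨hVmeas, n, hn⟩ := hV
    refine tendsto_const_nhds.congr fun m => ?_
    have hVn : eraseFrom (-m + ((m + n + 1 : ℕ) : ℤ)) ⁻¹' V = V := by
      ext p
      refine Eq.to_iff (hn p.1 fun t ht => if_pos ?_)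
      rw [Set.mem_Icc] at ht
      omega
    rw [← hVn, ← Measure.map_apply (measurable_eraseFrom _) hVmeas,
      ← Measure.map_apply (measurable_eraseFrom _) hVmeas, h.map_eraseFrom_runLaw hρ]
  exact ext_of_generate_finite _ generateFrom_localSets.symm
    isSetAlgebra_localSets.isSetRing.isSetSemiring.isPiSystem heq
    (heq _ isSetAlgebra_localSets.univ_mem)

end ResponseLaw

lemma exists_norm_pow_le_of_spectralRadius_lt_one {A : Type*} [NormedRing A] [NormedAlgebra ℂ A]
    [CompleteSpace A] {a : A} (ha : spectralRadius ℂ a < 1) :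
    ∃ K r : ℝ, 0 < K ∧ 0 < r ∧ r < 1 ∧ ∀ n, ‖a ^ n‖ ≤ K * r ^ n := by
  obtain ⟨r, har, hr1⟩ := ENNReal.lt_iff_exists_nnreal_btwn.1 ha
  have hr0 : 0 < r := by exact_mod_cast zero_le.trans_lt har
  have gelfand : ∀ᶠ n : ℕ in atTop, ‖a ^ n‖ ≤ (r : ℝ) ^ n := by
    filter_upwards [(spectrum.pow_nnnorm_pow_one_div_tendsto_nhds_spectralRadius a).eventually
      (gt_mem_nhds har), eventually_gt_atTop 0] with n hn hn0
    have := ENNReal.rpow_le_rpow hn.le (show (0 : ℝ) ≤ n by positivity)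
    rw [← ENNReal.rpow_mul, one_div, inv_mul_cancel₀ (by positivity), ENNReal.rpow_one,
      ENNReal.rpow_natCast] at this
    exact_mod_cast this
  obtain ⟨K, hK, hbound⟩ := Asymptotics.bound_of_isBigO_nat_atTop
    (f := fun n => a ^ n) (g'' := fun n => (r : ℝ) ^ n)
    (Asymptotics.IsBigO.of_bound 1 (gelfand.mono fun n hn => by
      rwa [one_mul, Real.norm_of_nonneg (by positivity)]))
  refine ⟨K, r, hK, by exact_mod_cast hr0, by exact_mod_cast hr1, fun n => ?_⟩
  have := hbound (x := n) (by positivity)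
  rwa [Real.norm_of_nonneg (by positivity)] at this

section Companion

variable {N q : ℕ}

/-- The companion map of the recursion `v_t = ∑ j, B_j v_{t-j}`, `1 ≤ j ≤ q`, acting on the states
`(v_t, …, v_{t-q})`. The redundant last entry makes the state nonempty when `q = 0`. -/
noncomputable def companion {𝕜 : Type*} [Field 𝕜] (B : Fin q → Matrix (Fin N) (Fin N) 𝕜) :
    (Fin (q + 1) → Fin N → 𝕜) →ₗ[𝕜] (Fin (q + 1) → Fin N → 𝕜) where
  toFun s := Fin.cons (∑ j, (B j).mulVec (s j.castSucc)) fun i => s i.castSucc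
  map_add' s s' := by
    ext i : 1
    cases i using Fin.cases <;> simp [Matrix.mulVec_add, Finset.sum_add_distrib]
  map_smul' c s := by
    ext i : 1
    cases i using Fin.cases <;> simp [Matrix.mulVec_smul, Finset.smul_sum]

@[simp] lemma companion_zero {𝕜 : Type*} [Field 𝕜] (B : Fin q → Matrix (Fin N) (Fin N) 𝕜)
    (s : Fin (q + 1) → Fin N → 𝕜) :
    companion B s 0 = ∑ j, (B j).mulVec (s j.castSucc) := rfl

@[simp] lemma companion_succ {𝕜 : Type*} [Field 𝕜] (B : Fin q → Matrix (Fin N) (Fin N) 𝕜)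
    (s : Fin (q + 1) → Fin N → 𝕜) (i : Fin q) : companion B s i.succ = s i.castSucc := rfl

lemma apply_eq_inv_pow_smul_of_companion_eq_smul {𝕜 : Type*} [Field 𝕜]
    {B : Fin q → Matrix (Fin N) (Fin N) 𝕜} {c : 𝕜} (hc : c ≠ 0) {s : Fin (q + 1) → Fin N → 𝕜}
    (hs : companion B s = c • s) (i : Fin (q + 1)) : s i = c⁻¹ ^ (i : ℕ) • s 0 := by
  induction i using Fin.induction with
  | zero => simp
  | succ i ih =>
    have hsucc : s i.castSucc = c • s i.succ := congrFun hs i.succ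
    rw [Fin.val_succ, pow_succ', mul_smul, ← Fin.val_castSucc i, ← ih, hsucc, inv_smul_smul₀ hc]

lemma mulVec_eq_zero_of_companion_eq_smul {𝕜 : Type*} [Field 𝕜]
    {B : Fin q → Matrix (Fin N) (Fin N) 𝕜} {c : 𝕜} (hc : c ≠ 0) {s : Fin (q + 1) → Fin N → 𝕜}
    (hs : companion B s = c • s) :
    (1 - ∑ j : Fin q, c⁻¹ ^ ((j : ℕ) + 1) • B j).mulVec (s 0) = 0 := by
  have hzero : ∑ j, (B j).mulVec (s j.castSucc) = c • s 0 := congrFun hs 0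
  rw [Matrix.sub_mulVec, Matrix.one_mulVec, Matrix.sum_mulVec, sub_eq_zero]
  calc s 0 = c⁻¹ • ∑ j, (B j).mulVec (s j.castSucc) := by rw [hzero, inv_smul_smul₀ hc]
    _ = ∑ j : Fin q, (c⁻¹ ^ ((j : ℕ) + 1) • B j).mulVec (s 0) := by
      rw [Finset.smul_sum]
      refine Finset.sum_congr rfl fun j _ => ?_
      rw [apply_eq_inv_pow_smul_of_companion_eq_smul hc hs, Matrix.mulVec_smul,
        Matrix.smul_mulVec, smul_smul, pow_succ', Fin.val_castSucc]

variable {B : Fin q → Matrix (Fin N) (Fin N) ℝ}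

lemma norm_lt_one_of_hasEigenvalue_companion (hB : RootsOutsideUnitDisc B) {c : ℂ}
    (hc : Module.End.HasEigenvalue (companion fun j => (B j).map Complex.ofReal) c) : ‖c‖ < 1 := by
  rcases eq_or_ne c 0 with rfl | hc0
  · simp
  obtain ⟨s, hs⟩ := hc.exists_hasEigenvector
  have hs0 : s 0 ≠ 0 := fun h0 => hs.2 <| funext fun i => by
    rw [apply_eq_inv_pow_smul_of_companion_eq_smul hc0 hs.apply_eq_smul, h0, smul_zero,
      Pi.zero_apply]
  have hroot := hB c⁻¹ (Matrix.exists_mulVec_eq_zero_iff.1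
    ⟨s 0, hs0, mulVec_eq_zero_of_companion_eq_smul hc0 hs.apply_eq_smul⟩)
  rw [norm_inv] at hroot
  exact (one_lt_inv₀ (norm_pos_iff.2 hc0)).1 hroot

lemma spectralRadius_companion_lt_one (hB : RootsOutsideUnitDisc B) :
    spectralRadius ℂ (Module.End.toContinuousLinearMap (Fin (q + 1) → Fin N → ℂ)
      (companion fun j => (B j).map Complex.ofReal)) < 1 := by
  rcases subsingleton_or_nontrivial (Fin (q + 1) → Fin N → ℂ) with _ | _
  · rw [Subsingleton.elim (Module.End.toContinuousLinearMap _ _) 0, spectrum.spectralRadius_zero]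
    exact zero_lt_one
  · refine (spectrum.spectralRadius_lt_of_forall_lt _ (r := 1) fun c hc => ?_).trans_le (by simp)
    rw [AlgEquiv.spectrum_eq] at hc
    exact_mod_cast norm_lt_one_of_hasEigenvalue_companion hB
      (Module.End.hasEigenvalue_iff_mem_spectrum.2 hc)

/-- The entrywise embedding of the real states of a recursion into the complex ones. -/
noncomputable def complexify (s : Fin (q + 1) → Fin N → ℝ) : Fin (q + 1) → Fin N → ℂ :=
  fun i j => s i j

lemma norm_complexify (s : Fin (q + 1) → Fin N → ℝ) : ‖complexify s‖ = ‖s‖ := by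
  simp [complexify, Pi.norm_def, Pi.nnnorm_def]

lemma complexify_companion_pow (B : Fin q → Matrix (Fin N) (Fin N) ℝ) (n : ℕ)
    (s : Fin (q + 1) → Fin N → ℝ) :
    complexify ((companion B ^ n) s)
      = (companion (fun j => (B j).map Complex.ofReal) ^ n) (complexify s) := by
  induction n with
  | zero => rfl
  | succ n ih =>
    rw [pow_succ', pow_succ', Module.End.mul_apply, Module.End.mul_apply, ← ih]
    ext i k
    cases i using Fin.cases <;> simp [complexify, Matrix.mulVec, dotProduct]

lemma exists_norm_companion_pow_le (hB : RootsOutsideUnitDisc B) :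
    ∃ K r : ℝ, 0 < K ∧ 0 < r ∧ r < 1 ∧ ∀ n s, ‖(companion B ^ n) s‖ ≤ K * r ^ n * ‖s‖ := by
  obtain ⟨K, r, hK, hr0, hr1, hKr⟩ :=
    exists_norm_pow_le_of_spectralRadius_lt_one (spectralRadius_companion_lt_one hB)
  refine ⟨K, r, hK, hr0, hr1, fun n s => ?_⟩
  rw [← norm_complexify, complexify_companion_pow, ← norm_complexify s]
  refine (ContinuousLinearMap.le_of_opNorm_le _ (hKr n) (complexify s)).trans' (le_of_eq ?_)
  rw [← map_pow]
  rfl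

end Companion

lemma norm_tsum_sub_tsum_le {ι E : Type*} [NormedAddCommGroup E] [CompleteSpace E]
    {f g : ι → E} {a : ι → ℝ} {s : ℝ} (ha : HasSum a s) (hfg : ∀ i, ‖f i - g i‖ ≤ a i) :
    ‖∑' i, f i - ∑' i, g i‖ ≤ s := by
  have hsub : Summable (f - g) := .of_norm_bounded ha.summable hfg
  by_cases hg : Summable g
  · have hf : Summable f := by simpa using hsub.add hg
    rw [← hf.tsum_sub hg]
    exact tsum_of_norm_bounded ha hfg
  · have hf : ¬ Summable f := fun hf => hg (by simpa using hf.sub hsub)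
    rw [tsum_eq_zero_of_not_summable hf, tsum_eq_zero_of_not_summable hg, sub_zero, norm_zero]
    exact ha.nonneg fun i => (norm_nonneg _).trans (hfg i)

section Filtering

variable {N q : ℕ} (B : Fin q → Matrix (Fin N) (Fin N) ℝ)

/-- The response of the recursion `v_t = ∑ j, B_j v_{t-j}` to an impulse: the state after `n` steps
when the entry `v` is added at time `0` to the zero state. -/
noncomputable def impulse (n : ℕ) : (Fin N → ℝ) →ₗ[ℝ] (Fin (q + 1) → Fin N → ℝ) :=
  (companion B ^ n) ∘ₗ LinearMap.single ℝ (fun _ => Fin N → ℝ) 0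

lemma impulse_apply (n : ℕ) (v : Fin N → ℝ) :
    impulse B n v = (companion B ^ n) (Pi.single 0 v) := rfl

/-- The state at time `t` of the recursion `v_t = ∑ j, B_j v_{t-j} + w_t` started in the infinite
past (`0` where the defining series diverges). -/
noncomputable def filterState (w : ℤ → Fin N → ℝ) (t : ℤ) : Fin (q + 1) → Fin N → ℝ :=
  ∑' n : ℕ, impulse B n (w (t - n))

lemma measurable_filterState (t : ℤ) :
    Measurable fun w : ℤ → Fin N → ℝ => filterState B w t :=
  Measurable.tsum fun n =>
    (impulse B n).toContinuousLinearMap.continuous.measurable.comp (measurable_pi_apply _)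

lemma filterState_shiftBy (w : ℤ → Fin N → ℝ) (s t : ℤ) :
    filterState B (shiftBy s w) t = filterState B w (t + s) := by
  simp only [filterState, shiftBy_apply, sub_add_eq_add_sub]

variable {B} {w : ℤ → Fin N → ℝ} {t : ℤ}

lemma filterState_congr {w' : ℤ → Fin N → ℝ} (h : ∀ s ≤ t, w s = w' s) :
    filterState B w t = filterState B w' t := by
  simp only [filterState, h _ (sub_le_self t (Int.natCast_nonneg _))]

lemma filterState_eq_companion_add (hw : ∀ t, Summable fun n : ℕ => impulse B n (w (t - n)))
    (t : ℤ) :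
    filterState B w t = companion B (filterState B w (t - 1)) + Pi.single 0 (w t) := by
  have hcompanion : companion B (filterState B w (t - 1))
      = ∑' n : ℕ, impulse B (n + 1) (w (t - (n + 1 : ℕ))) := by
    refine ((companion B).toContinuousLinearMap.map_tsum (hw (t - 1))).trans
      (tsum_congr fun n => ?_)
    rw [impulse_apply _ (n + 1), pow_succ', Module.End.mul_apply,
      show t - ((n + 1 : ℕ) : ℤ) = t - 1 - n by push_cast; ring]
    rfl
  rw [hcompanion, filterState, (hw t).tsum_eq_zero_add]
  simp [impulse_apply, add_comm]

lemma filterState_apply (hw : ∀ t, Summable fun n : ℕ => impulse B n (w (t - n)))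
    (t : ℤ) (j : Fin (q + 1)) : filterState B w t j = filterState B w (t - (j : ℕ)) 0 := by
  induction j using Fin.induction generalizing t with
  | zero => simp
  | succ j ih =>
    rw [filterState_eq_companion_add hw, Pi.add_apply, companion_succ, ih,
      Pi.single_eq_of_ne (Fin.succ_ne_zero j), add_zero, Fin.val_castSucc, Fin.val_succ,
      show t - ((j + 1 : ℕ) : ℤ) = t - 1 - (j : ℕ) by push_cast; ring]

lemma filterState_recursion (hw : ∀ t, Summable fun n : ℕ => impulse B n (w (t - n))) (t : ℤ) :
    filterState B w t 0
      = ∑ j : Fin q, (B j).mulVec (filterState B w (t - ((j : ℕ) + 1)) 0) + w t := by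
  conv_lhs => rw [filterState_eq_companion_add hw]
  simp only [Pi.add_apply, companion_zero, Pi.single_eq_same, filterState_apply hw (t - 1),
    Fin.val_castSucc, sub_sub, add_comm (1 : ℤ)]

lemma companion_state_of_recursion {m : ℤ → Fin N → ℝ}
    (hm : ∀ t, m t = ∑ j : Fin q, (B j).mulVec (m (t - ((j : ℕ) + 1))) + w t) (t : ℤ) :
    (fun j : Fin (q + 1) => m (t - (j : ℕ)))
      = companion B (fun j : Fin (q + 1) => m (t - 1 - (j : ℕ))) + Pi.single 0 (w t) := by
  ext j : 1
  cases j using Fin.cases with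
  | zero =>
    simp only [Fin.val_zero, Nat.cast_zero, sub_zero, Pi.add_apply, companion_zero,
      Pi.single_eq_same, Fin.val_castSucc, sub_sub, add_comm (1 : ℤ)]
    exact hm t
  | succ j =>
    simp only [Pi.add_apply, companion_succ, Pi.single_eq_of_ne (Fin.succ_ne_zero j), add_zero,
      Fin.val_succ, Fin.val_castSucc, Nat.cast_add, Nat.cast_one, sub_sub, add_comm (1 : ℤ)]

lemma state_eq_companion_pow_add_sum {s : ℤ → Fin (q + 1) → Fin N → ℝ}
    (hs : ∀ t, s t = companion B (s (t - 1)) + Pi.single 0 (w t)) (t : ℤ) (n : ℕ) :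
    s t = (companion B ^ n) (s (t - n)) + ∑ k ∈ Finset.range n, impulse B k (w (t - k)) := by
  induction n with
  | zero => simp
  | succ n ih =>
    rw [Finset.sum_range_succ, ih, hs (t - n), map_add, pow_succ, Module.End.mul_apply,
      show t - (n : ℤ) - 1 = t - ((n + 1 : ℕ) : ℤ) by push_cast; ring, impulse_apply]
    abel

lemma tendsto_companion_pow_of_recursion {m : ℤ → Fin N → ℝ}
    (hm : ∀ t, m t = ∑ j : Fin q, (B j).mulVec (m (t - ((j : ℕ) + 1))) + w t)
    (hw : Summable fun n : ℕ => impulse B n (w (t - n))) :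
    Tendsto (fun n : ℕ => (companion B ^ n) (fun j : Fin (q + 1) => m (t - n - (j : ℕ)))) atTop
      (𝓝 ((fun j : Fin (q + 1) => m (t - (j : ℕ))) - filterState B w t)) :=
  (tendsto_const_nhds.sub hw.hasSum.tendsto_sum_nat).congr fun n => sub_eq_of_eq_add <|
    state_eq_companion_pow_add_sum (s := fun t (j : Fin (q + 1)) => m (t - (j : ℕ)))
      (companion_state_of_recursion hm) t n

end Filtering

section Stable

variable {N q : ℕ} {B : Fin q → Matrix (Fin N) (Fin N) ℝ}

lemma exists_norm_impulse_le (hB : RootsOutsideUnitDisc B) :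
    ∃ K r : ℝ, 0 < K ∧ 0 < r ∧ r < 1 ∧ ∀ n v, ‖impulse B n v‖ ≤ K * r ^ n * ‖v‖ := by
  obtain ⟨K, r, hK, hr0, hr1, hKr⟩ := exists_norm_companion_pow_le hB
  exact ⟨K, r, hK, hr0, hr1, fun n v =>
    (hKr n _).trans_eq (by rw [LinearMap.single_apply, Pi.norm_single])⟩

lemma summable_impulse_of_bounded (hB : RootsOutsideUnitDisc B) {w : ℤ → Fin N → ℝ} {a : ℝ}
    (hw : ∀ t, ‖w t‖ ≤ a) (t : ℤ) : Summable fun n : ℕ => impulse B n (w (t - n)) := by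
  obtain ⟨K, r, hK, hr0, hr1, hKr⟩ := exists_norm_impulse_le hB
  refine .of_norm_bounded (((summable_geometric_of_lt_one hr0.le hr1).mul_left K).mul_right a)
    fun n => (hKr n _).trans ?_
  gcongr
  exact hw _

lemma exists_norm_filterState_sub_le (hB : RootsOutsideUnitDisc B) :
    ∃ D r : ℝ, 0 < D ∧ 0 < r ∧ r < 1 ∧ ∀ (w w' : ℤ → Fin N → ℝ) (t : ℤ) (m : ℕ) (a : ℝ),
      (∀ s ≤ t, ‖w s - w' s‖ ≤ a) → (∀ s ≤ t, t - m < s → w s = w' s) →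
        ‖filterState B w t - filterState B w' t‖ ≤ D * (a * r ^ m) := by
  obtain ⟨K, r, hK, hr0, hr1, hKr⟩ := exists_norm_impulse_le hB
  refine ⟨K * (1 - r)⁻¹, r, mul_pos hK (inv_pos.2 (sub_pos.2 hr1)), hr0, hr1,
    fun w w' t m a hle heq => ?_⟩
  have htail : HasSum (fun n : ℕ => if n < m then 0 else K * r ^ n * a)
      (K * (1 - r)⁻¹ * (a * r ^ m)) := by
    refine (hasSum_nat_add_iff' m).1 ?_
    rw [Finset.sum_eq_zero fun n hn => if_pos (Finset.mem_range.1 hn), sub_zero]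
    refine (((hasSum_geometric_of_lt_one hr0.le hr1).mul_left K).mul_right (a * r ^ m)).congr_fun
      fun n => ?_
    rw [if_neg (by omega), pow_add]
    ring
  refine norm_tsum_sub_tsum_le htail fun n => ?_
  have hn : t - (n : ℤ) ≤ t := sub_le_self t (Int.natCast_nonneg n)
  split_ifs with hnm
  · rw [heq _ hn (by omega), sub_self, norm_zero]
  · rw [← map_sub]
    refine (hKr n _).trans ?_
    gcongr
    exact hle _ hn

end Stable

section LogMoment

lemma ae_eventually_comp_shiftBy_le {α : Type*} [MeasurableSpace α] {lam : Measure (ℤ → α)}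
    [IsProbabilityMeasure lam] (hlam : MeasurePreserving shift lam lam) {f : (ℤ → α) → ℝ}
    (hf : Integrable f lam) (hf0 : 0 ≤ f) (t : ℤ) :
    ∀ᵐ x ∂lam, ∀ᶠ n : ℕ in atTop, f (shiftBy (t - n) x) ≤ n := by
  have hsum : ∑' n : ℕ, lam {x | f (shiftBy (t - n) x) ∈ Set.Ioi (n : ℝ)} ≠ ∞ := by
    have hshift (n : ℕ) : lam {x | f (shiftBy (t - n) x) ∈ Set.Ioi (n : ℝ)}
        = lam {x | f x ∈ Set.Ioi (n : ℝ)} :=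
      (measurePreserving_shiftBy hlam (t - n)).measure_preimage
        (hf.aemeasurable.nullMeasurable measurableSet_Ioi)
    simp only [hshift]
    let _ : MeasureSpace (ℤ → α) := ⟨lam⟩
    exact (tsum_prob_mem_Ioi_lt_top hf hf0).ne
  filter_upwards [ae_eventually_notMem hsum] with x hx
  exact hx.mono fun n hn => not_lt.1 hn

lemma summable_pow_mul_of_eventually_posLog_le {a : ℕ → ℝ} (ha : ∀ n, 0 ≤ a n) {r c : ℝ}
    (hr : 0 ≤ r) (hrc : r * Real.exp c < 1) (h : ∀ᶠ n : ℕ in atTop, Real.posLog (a n) ≤ n * c) :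
    Summable fun n => r ^ n * a n := by
  refine summable_of_isBigO_nat (summable_geometric_of_lt_one (by positivity) hrc)
    (Asymptotics.IsBigO.of_bound 1 (h.mono fun n hn => ?_))
  have han : a n ≤ Real.exp c ^ n := by
    rw [← Real.exp_nat_mul]
    rcases (ha n).eq_or_lt with h0 | h0
    · rw [← h0]
      positivity
    · exact (Real.log_le_iff_le_exp h0).1 ((le_max_right _ _).trans hn)
  rw [one_mul, Real.norm_of_nonneg (mul_nonneg (by positivity) (ha n)),
    Real.norm_of_nonneg (by positivity), mul_pow]
  gcongr

lemma ae_summable_pow_mul_norm {V : Type*} [NormedAddCommGroup V] [MeasurableSpace V]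
    {lam : Measure (ℤ → V)} [IsProbabilityMeasure lam] (hlam : MeasurePreserving shift lam lam)
    (hlog : Integrable (fun x => Real.posLog ‖x 0‖) lam) {r : ℝ} (hr0 : 0 < r) (hr1 : r < 1) :
    ∀ᵐ x ∂lam, ∀ t : ℤ, Summable fun n : ℕ => r ^ n * ‖x (t - n)‖ := by
  obtain ⟨c, hc0, hc⟩ := exists_between (neg_pos.2 (Real.log_neg hr0 hr1))
  have hrc : r * Real.exp c < 1 := by
    rw [← Real.exp_log hr0, ← Real.exp_add, Real.exp_lt_one_iff]
    linarith
  refine ae_all_iff.2 fun t => ?_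
  filter_upwards [ae_eventually_comp_shiftBy_le hlam (hlog.div_const c)
    (fun x => div_nonneg Real.posLog_nonneg hc0.le) t] with x hx
  refine summable_pow_mul_of_eventually_posLog_le (fun _ => norm_nonneg _) hr0.le hrc
    (hx.mono fun n hn => ?_)
  rwa [shiftBy_apply, zero_add, div_le_iff₀ hc0] at hn

lemma ae_summable_impulse_mulVec {N d q : ℕ} {B : Fin q → Matrix (Fin N) (Fin N) ℝ}
    (hB : RootsOutsideUnitDisc B) (Γ : Matrix (Fin N) (Fin d) ℝ)
    {lam : Measure (ℤ → Fin d → ℝ)} [IsProbabilityMeasure lam]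
    (hlam : MeasurePreserving shift lam lam)
    (hlog : Integrable (fun x => Real.posLog ‖x 0‖) lam) :
    ∀ᵐ x ∂lam, ∀ t : ℤ, Summable fun n : ℕ => impulse B n (Γ.mulVec (x (t - n))) := by
  obtain ⟨K, r, hK, hr0, hr1, hKr⟩ := exists_norm_impulse_le hB
  filter_upwards [ae_summable_pow_mul_norm hlam hlog hr0 hr1] with x hx t
  set G := (Matrix.toLin' Γ).toContinuousLinearMap
  refine .of_norm_bounded ((hx t).mul_left (K * ‖G‖)) fun n => ?_
  calc ‖impulse B n (Γ.mulVec (x (t - n)))‖ ≤ K * r ^ n * ‖G (x (t - n))‖ := hKr n _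
    _ ≤ K * r ^ n * (‖G‖ * ‖x (t - n)‖) := by gcongr; exact G.le_opNorm _
    _ = K * ‖G‖ * (r ^ n * ‖x (t - n)‖) := by ring

end LogMoment

section Choice

variable {N : ℕ}

/-- The set of alternatives chosen when the latent vector is `c` and the noise is `e`. -/
def choose (c e : Fin N → ℝ) : Set (Fin N) := {i | 0 < c i + e i}

lemma measurable_choose : Measurable fun p : (Fin N → ℝ) × (Fin N → ℝ) => choose p.1 p.2 :=
  measurable_set_iff.2 fun i => measurableSet_setOfPred.1 <| measurableSet_lt measurable_const <|
    ((measurable_pi_apply i).comp measurable_fst).add ((measurable_pi_apply i).comp measurable_snd)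

lemma setOf_choose_eq (c : Fin N → ℝ) (I : Set (Fin N)) : {e | choose c e = I} = cell I c := by
  ext e
  simp only [choose, cell, Set.ext_iff, Set.mem_ofPred_eq, ← forall_and]
  refine forall_congr' fun i => ?_
  by_cases hi : i ∈ I <;> simp only [hi, iff_true, iff_false, not_true, not_false_eq_true, not_lt,
    forall_true_left, false_implies, true_and, and_true] <;>
    constructor <;> intro h <;> linarith

/-- The noise values whose distance to every choice threshold `-c i` is at least `ρ`: a
perturbation of the latent vector `c` by at most `ρ` does not change the choice they make. -/
def safeNoise (ρ : ℝ) (c : Fin N → ℝ) : Set (Fin N → ℝ) :=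
  {e | ∀ i, e i ≤ -c i - ρ ∨ -c i + ρ < e i}

lemma measurableSet_safeNoise (ρ : ℝ) :
    MeasurableSet {p : (Fin N → ℝ) × (Fin N → ℝ) | p.2 ∈ safeNoise ρ p.1} := by
  have hc (i : Fin N) : Measurable fun p : (Fin N → ℝ) × (Fin N → ℝ) => p.1 i :=
    (measurable_pi_apply i).comp measurable_fst
  have he (i : Fin N) : Measurable fun p : (Fin N → ℝ) × (Fin N → ℝ) => p.2 i :=
    (measurable_pi_apply i).comp measurable_snd
  have hinter : {p : (Fin N → ℝ) × (Fin N → ℝ) | p.2 ∈ safeNoise ρ p.1}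
      = ⋂ i, {p | p.2 i ≤ -p.1 i - ρ} ∪ {p | -p.1 i + ρ < p.2 i} := by
    ext
    simp [safeNoise]
  rw [hinter]
  exact .iInter fun i => .union (measurableSet_le (he i) ((hc i).neg.sub_const ρ))
    (measurableSet_lt ((hc i).neg.add_const ρ) (he i))

lemma choose_eq_of_mem_safeNoise {ρ : ℝ} {c c' e : Fin N → ℝ} (hc : ‖c' - c‖ ≤ ρ)
    (he : e ∈ safeNoise ρ c) : choose c' e = choose c e := by
  ext i
  have hi := abs_le.1 ((norm_le_pi_norm (c' - c) i).trans hc)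
  rw [Pi.sub_apply] at hi
  simp only [choose, Set.mem_ofPred_eq]
  rcases he i with h | h <;> constructor <;> intro <;> linarith

variable {ν : Measure (Fin N → ℝ)} [IsProbabilityMeasure ν]

lemma measureReal_Iic_update_sdiff_le {K : NNReal} (hK : LipschitzWith K (jointCdf ν))
    (b : Fin N → ℝ) (i : Fin N) {s s' : ℝ} (hs : s ≤ s') :
    ν.real (Set.Iic (Function.update b i s') \ Set.Iic (Function.update b i s))
      ≤ K * (s' - s) := by
  have hle : Function.update b i s ≤ Function.update b i s' :=
    update_le_update_iff.2 ⟨hs, fun _ _ => le_rfl⟩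
  have hdist : dist (Function.update b i s') (Function.update b i s) ≤ s' - s := by
    refine (dist_pi_le_iff (sub_nonneg.2 hs)).2 fun j => ?_
    rcases eq_or_ne j i with rfl | hj
    · simp [Real.dist_eq, abs_of_nonneg (sub_nonneg.2 hs)]
    · simp [hj, hs]
  rw [measureReal_sdiff (Set.Iic_subset_Iic.2 hle) measurableSet_Iic]
  exact (le_abs_self _).trans
    ((hK.dist_le_mul _ _).trans (mul_le_mul_of_nonneg_left hdist K.2))

lemma measure_eval_preimage_Ioc_le {K : NNReal} (hK : LipschitzWith K (jointCdf ν)) (i : Fin N)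
    {s s' : ℝ} (hs : s ≤ s') :
    ν (Function.eval i ⁻¹' Set.Ioc s s') ≤ ENNReal.ofReal (K * (s' - s)) := by
  set D : ℕ → Set (Fin N → ℝ) := fun M =>
    Set.Iic (Function.update (fun _ => (M : ℝ)) i s')
      \ Set.Iic (Function.update (fun _ => (M : ℝ)) i s) with hD
  have mem_D {M : ℕ} {e : Fin N → ℝ} :
      e ∈ D M ↔ e i ∈ Set.Ioc s s' ∧ ∀ j, j ≠ i → e j ≤ M := by
    simp only [hD, Set.mem_sdiff, Set.mem_Iic, le_update_iff, Set.mem_Ioc, ← not_le]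
    tauto
  have hmono : Monotone D := fun M M' hM e he =>
    mem_D.2 ⟨(mem_D.1 he).1, fun j hj => ((mem_D.1 he).2 j hj).trans (by exact_mod_cast hM)⟩
  have hunion : Function.eval i ⁻¹' Set.Ioc s s' ⊆ ⋃ M, D M := fun e he => by
    obtain ⟨M, hM⟩ := exists_nat_ge ‖e‖
    exact Set.mem_iUnion.2 ⟨M, mem_D.2
      ⟨he, fun j _ => (le_abs_self _).trans ((norm_le_pi_norm e j).trans hM)⟩⟩
  refine (measure_mono hunion).trans (hmono.measure_iUnion.trans_le (iSup_le fun M => ?_))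
  rw [← ofReal_measureReal]
  exact ENNReal.ofReal_le_ofReal (measureReal_Iic_update_sdiff_le hK _ i hs)

lemma measure_compl_safeNoise_le {K : NNReal} (hK : LipschitzWith K (jointCdf ν)) {ρ : ℝ}
    (hρ : 0 ≤ ρ) (c : Fin N → ℝ) :
    ν (safeNoise ρ c)ᶜ ≤ N * ENNReal.ofReal (K * (2 * ρ)) := by
  have hsub : (safeNoise ρ c)ᶜ
      ⊆ ⋃ i ∈ Finset.univ, Function.eval i ⁻¹' Set.Ioc (-c i - ρ) (-c i + ρ) := fun e he => by
    obtain ⟨i, hi⟩ := not_forall.1 he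
    rw [not_or, not_le, not_lt] at hi
    exact Set.mem_iUnion₂.2 ⟨i, Finset.mem_univ i, hi⟩
  calc ν (safeNoise ρ c)ᶜ
      ≤ ∑ i : Fin N, ν (Function.eval i ⁻¹' Set.Ioc (-c i - ρ) (-c i + ρ)) :=
        (measure_mono hsub).trans (measure_biUnion_finset_le _ _)
    _ ≤ ∑ _i : Fin N, ENNReal.ofReal (K * (2 * ρ)) := Finset.sum_le_sum fun i _ =>
        (measure_eval_preimage_Ioc_le hK i (by linarith)).trans_eq (by ring_nf)
    _ = N * ENNReal.ofReal (K * (2 * ρ)) := by simp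

omit [IsProbabilityMeasure ν] in
lemma measure_safeNoise_ne_zero (hν : ν.support = Set.univ) (ρ : ℝ) (c : Fin N → ℝ) :
    ν (safeNoise ρ c) ≠ 0 := by
  have hmem : (fun i => -c i + ρ + 1) ∈ ν.support := hν ▸ Set.mem_univ _
  have hopen : IsOpen (Set.univ.pi fun i => Set.Ioi (-c i + ρ)) :=
    isOpen_set_pi Set.finite_univ fun _ _ => isOpen_Ioi
  have hpos := (Measure.mem_support_iff_forall _).1 hmem _
    (hopen.mem_nhds fun i _ => lt_add_one (-c i + ρ))
  have hsub : (Set.univ.pi fun i => Set.Ioi (-c i + ρ)) ⊆ safeNoise ρ c :=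
    fun e he i => Or.inr (he i trivial)
  exact (hpos.trans_le (measure_mono hsub)).ne'

end Choice

section Response

variable {N d p q : ℕ}

lemma norm_indicatorVec_le (I : Set (Fin N)) : ‖indicatorVec I‖ ≤ 1 :=
  (pi_norm_le_iff_of_nonneg zero_le_one).2 fun i =>
    (norm_indicator_le_norm_self (fun _ => (1 : ℝ)) i).trans norm_one.le

lemma measurable_mulVec {m n : ℕ} (M : Matrix (Fin m) (Fin n) ℝ) :
    Measurable fun v : Fin n → ℝ => M.mulVec v :=
  (Matrix.toLin' M).toContinuousLinearMap.continuous.measurable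

section Feedback

variable (A : Fin p → Matrix (Fin N) (Fin N) ℝ)

/-- The contribution `∑ k, A_k Y_{t-k}` of earlier choices to the latent recursion, where `z t` is
the set of alternatives chosen at time `t`. -/
noncomputable def feedback (z : ℤ → Set (Fin N)) (t : ℤ) : Fin N → ℝ :=
  ∑ k : Fin p, (A k).mulVec (indicatorVec (z (t - ((k : ℕ) + 1))))

lemma feedback_congr {z z' : ℤ → Set (Fin N)} {t : ℤ} (h : ∀ s ∈ Set.Ico (t - p) t, z s = z' s) :
    feedback A z t = feedback A z' t :=
  Finset.sum_congr rfl fun k _ => by rw [h _ ⟨by omega, by omega⟩]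

lemma feedback_shiftBy (z : ℤ → Set (Fin N)) (s t : ℤ) :
    feedback A (shiftBy s z) t = feedback A z (t + s) := by
  simp only [feedback, shiftBy_apply, sub_add_eq_add_sub]

lemma measurable_feedback (t : ℤ) : Measurable fun z : ℤ → Set (Fin N) => feedback A z t :=
  Finset.measurable_sum _ fun k _ => (measurable_mulVec (A k)).comp
    ((Measurable.of_discrete (f := indicatorVec)).comp (measurable_pi_apply _))

lemma exists_norm_feedback_le : ∃ a : ℝ, 0 ≤ a ∧ ∀ z t, ‖feedback A z t‖ ≤ a := by
  refine ⟨∑ k, ‖(Matrix.toLin' (A k)).toContinuousLinearMap‖, by positivity,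
    fun z t => norm_sum_le_of_le _ fun k _ => ?_⟩
  exact (Matrix.toLin' (A k)).toContinuousLinearMap.le_of_opNorm_le_of_le le_rfl
    (norm_indicatorVec_le _) |>.trans_eq (mul_one _)

end Feedback

variable (B : Fin q → Matrix (Fin N) (Fin N) ℝ) (A : Fin p → Matrix (Fin N) (Fin N) ℝ)
  (Γ : Matrix (Fin N) (Fin d) ℝ)

/-- The input of the latent recursion: what is added to `∑ j, B_j μ_{t-j}` to obtain `μ_t`. -/
noncomputable def input (x : ℤ → Fin d → ℝ) (z : ℤ → Set (Fin N)) (t : ℤ) : Fin N → ℝ :=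
  feedback A z t + Γ.mulVec (x t)

lemma measurable_input :
    Measurable fun p : (ℤ → Fin d → ℝ) × (ℤ → Set (Fin N)) => input A Γ p.1 p.2 :=
  measurable_pi_lambda _ fun t => ((measurable_feedback A t).comp measurable_snd).add
    ((measurable_mulVec Γ).comp ((measurable_pi_apply t).comp measurable_fst))

/-- The latent vector at time `0`, as a function of the covariates and of the earlier choices. -/
noncomputable def latent (x : ℤ → Fin d → ℝ) (z : ℤ → Set (Fin N)) : Fin N → ℝ :=
  filterState B (input A Γ x z) 0 0

lemma measurable_latent :
    Measurable fun p : (ℤ → Fin d → ℝ) × (ℤ → Set (Fin N)) => latent B A Γ p.1 p.2 :=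
  (measurable_pi_apply 0).comp ((measurable_filterState B 0).comp (measurable_input A Γ))

lemma latent_dependsOn_past (x : ℤ → Fin d → ℝ) :
    DependsOn (fun z => latent B A Γ x z) (Set.Iio 0) := by
  intro z z' h
  refine congrFun (filterState_congr fun s hs => ?_) 0
  rw [input, input, feedback_congr A fun r hr => h r (lt_of_lt_of_le hr.2 hs)]

lemma latent_shiftBy (x : ℤ → Fin d → ℝ) (z : ℤ → Set (Fin N)) (t : ℤ) :
    latent B A Γ (shiftBy t x) (shiftBy t z) = filterState B (input A Γ x z) t 0 := by
  have hinput : input A Γ (shiftBy t x) (shiftBy t z) = shiftBy t (input A Γ x z) := by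
    ext s : 1
    simp only [input, feedback_shiftBy, shiftBy_apply]
  rw [latent, hinput, filterState_shiftBy, zero_add]

/-- The choice at time `0`, as a function of the covariates, the earlier choices and the noise. -/
noncomputable def choiceResponse (x : ℤ → Fin d → ℝ) (z : ℤ → Set (Fin N)) (e : Fin N → ℝ) :
    Set (Fin N) :=
  choose (latent B A Γ x z) e

variable {B}

lemma summable_impulse_input (hB : RootsOutsideUnitDisc B) {x : ℤ → Fin d → ℝ} {t : ℤ}
    (hx : Summable fun n : ℕ => impulse B n (Γ.mulVec (x (t - n)))) (z : ℤ → Set (Fin N)) :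
    Summable fun n : ℕ => impulse B n (input A Γ x z (t - n)) := by
  obtain ⟨a, -, ha⟩ := exists_norm_feedback_le A
  simpa only [input, map_add] using (summable_impulse_of_bounded hB (ha z) t).add hx

lemma exists_norm_latent_sub_le (hB : RootsOutsideUnitDisc B) :
    ∃ D r : ℝ, 0 ≤ D ∧ 0 < r ∧ r < 1 ∧ ∀ (x : ℤ → Fin d → ℝ) (z z' : ℤ → Set (Fin N)) (l : ℕ),
      (∀ s ∈ Set.Ico (-(l : ℤ)) 0, z' s = z s) →
        ‖latent B A Γ x z' - latent B A Γ x z‖ ≤ D * r ^ (l - p) := by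
  obtain ⟨a, ha0, ha⟩ := exists_norm_feedback_le A
  obtain ⟨D, r, hD, hr0, hr1, hDr⟩ := exists_norm_filterState_sub_le hB
  refine ⟨D * (a + a), r, by positivity, hr0, hr1, fun x z z' l hz => ?_⟩
  have hle (s : ℤ) : ‖input A Γ x z' s - input A Γ x z s‖ ≤ a + a := by
    rw [input, input, add_sub_add_right_eq_sub]
    exact norm_sub_le_of_le (ha z' s) (ha z s)
  have heq (s : ℤ) (hs0 : s ≤ 0) (hs : 0 - ((l - p : ℕ) : ℤ) < s) :
      input A Γ x z' s = input A Γ x z s := by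
    rw [input, input, feedback_congr A fun r hr => hz r ?_]
    rw [Set.mem_Ico] at hr ⊢
    omega
  rw [mul_assoc]
  exact (norm_le_pi_norm (filterState B (input A Γ x z') 0 - filterState B (input A Γ x z) 0)
    0).trans (hDr _ _ 0 (l - p) (a + a) (fun s _ => hle s) heq)

variable (B)

lemma measurable_latent_prodMk_noise :
    Measurable fun q : (ℤ → Fin d → ℝ) × (ℤ → Set (Fin N)) × (Fin N → ℝ) =>
      (latent B A Γ q.1 q.2.1, q.2.2) :=
  ((measurable_latent B A Γ).comp (measurable_fst.prodMk (measurable_fst.comp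
    measurable_snd))).prodMk (measurable_snd.comp measurable_snd)

lemma isCausal_choiceResponse : IsCausal (choiceResponse B A Γ) where
  measurable := measurable_choose.comp (measurable_latent_prodMk_noise B A Γ)
  dependsOn_past x e _ _ h := congrArg (choose · e) (latent_dependsOn_past B A Γ x h)

variable {B}

-- By stability the choices before time `-l` move the latent vector by at most `D * r ^ (l - p)`.
theorem exists_isRegenerative_choiceResponse (hB : RootsOutsideUnitDisc B)
    {ν : Measure (Fin N → ℝ)} [IsProbabilityMeasure ν] (hνsupp : ν.support = Set.univ)
    (hνLip : ∃ K : NNReal, LipschitzWith K (jointCdf ν)) :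
    ∃ U β, IsRegenerative ν (choiceResponse B A Γ) U β := by
  obtain ⟨K, hK⟩ := hνLip
  obtain ⟨D, r, hD, hr0, hr1, hDr⟩ := exists_norm_latent_sub_le A Γ hB
  have hsummable : Summable fun l : ℕ => D * r ^ (l - p) :=
    (summable_nat_add_iff p).1 <| by
      simpa only [Nat.add_sub_cancel] using (summable_geometric_of_lt_one hr0.le hr1).mul_left D
  refine ⟨fun l x z => safeNoise (D * r ^ (l - p)) (latent B A Γ x z),
    fun l => N * ENNReal.ofReal (K * (2 * (D * r ^ (l - p)))), ?_⟩
  exact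
  { toIsCausal := isCausal_choiceResponse B A Γ
    measurableSet_good l := (measurableSet_safeNoise (D * r ^ (l - p))).preimage
      (measurable_latent_prodMk_noise B A Γ)
    good_dependsOn_past l x _ _ h :=
      congrArg (safeNoise (D * r ^ (l - p))) (latent_dependsOn_past B A Γ x h)
    eq_of_mem_good he hz := choose_eq_of_mem_safeNoise (hDr _ _ _ _ hz) he
    measure_good_ne_zero _ _ _ := measure_safeNoise_ne_zero hνsupp _ _
    measure_compl_good_le _ _ _ := measure_compl_safeNoise_le hK (by positivity) _
    tsum_ne_top := by
      rw [ENNReal.tsum_mul_left]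
      exact ENNReal.mul_ne_top (ENNReal.natCast_ne_top N)
        ((hsummable.mul_left 2).mul_left (K : ℝ)).tsum_ofReal_ne_top }

end Response

section StationarySolution

variable {Ω α γ : Type*} [MeasurableSpace Ω] [MeasurableSpace α] [MeasurableSpace γ]
  {P : Measure Ω} {Z : ℤ → Ω → α}

lemma IsStationary.identDistrib_shiftBy (h : IsStationary P Z) (hZ : ∀ t, Measurable (Z t))
    {g : (ℤ → α) → γ} (hg : Measurable g) (s : ℤ) :
    IdentDistrib (fun ω => g (shiftBy s fun t => Z t ω)) (fun ω => g fun t => Z t ω) P P := by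
  have hpath : Measurable fun ω t => Z t ω := measurable_pi_lambda _ hZ
  have hshift : Measurable fun z : ℤ → α => g (shiftBy s z) := hg.comp (measurable_shiftBy s)
  refine ⟨(hshift.comp hpath).aemeasurable, (hg.comp hpath).aemeasurable, ?_⟩
  calc P.map (fun ω => g (shiftBy s fun t => Z t ω))
      = ((processLaw P Z).map (shiftBy s)).map g := by
        rw [processLaw, Measure.map_map (measurable_shiftBy s) hpath,
          Measure.map_map hg ((measurable_shiftBy s).comp hpath)]
        rfl
    _ = P.map fun ω => g fun t => Z t ω := by
        rw [(measurePreserving_shiftBy h s).map_eq, processLaw, Measure.map_map hg hpath]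
        rfl

lemma measurePreserving_comp_path (hZ : ∀ t, Measurable (Z t)) {f : α → γ} (hf : Measurable f) :
    MeasurePreserving (fun z t => f (z t)) (processLaw P Z)
      (processLaw P fun t ω => f (Z t ω)) := by
  have hmeas : Measurable fun (z : ℤ → α) t => f (z t) := by fun_prop
  exact ⟨hmeas, Measure.map_map hmeas (measurable_pi_lambda _ hZ)⟩

lemma IsStationary.comp (h : IsStationary P Z) (hZ : ∀ t, Measurable (Z t)) {f : α → γ}
    (hf : Measurable f) : IsStationary P fun t ω => f (Z t ω) :=
  (measurePreserving_comp_path hZ hf).of_semiconj h (fun _ => rfl) (measurable_shiftBy 1)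

lemma IsErgodic.comp (h : IsErgodic P Z) (hZ : ∀ t, Measurable (Z t)) {f : α → γ}
    (hf : Measurable f) : IsErgodic P fun t ω => f (Z t ω) :=
  (measurePreserving_comp_path hZ hf).ergodic_of_ergodic_semiconj h (measurable_shiftBy 1)
    fun _ => rfl

end StationarySolution

section StationaryRecursion

variable {Ω : Type*} [MeasurableSpace Ω] {P : Measure Ω} [IsFiniteMeasure P]

lemma tendstoInMeasure_zero_of_norm_le_mul {V : Type*} [SeminormedAddCommGroup V]
    {f : ℕ → Ω → V} {c : ℕ → ℝ} (hc : Tendsto c atTop (𝓝 0)) {Z : ℕ → Ω → ℝ} {W : Ω → ℝ}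
    (hZ : ∀ n, IdentDistrib (Z n) W P P) (hf : ∀ n ω, ‖f n ω‖ ≤ c n * Z n ω) :
    TendstoInMeasure P f atTop 0 := by
  have hW : TendstoInMeasure P (fun n ω => c n * W ω) atTop 0 := by
    refine tendstoInMeasure_of_tendsto_ae
      (fun n => ((hZ n).aemeasurable_snd.const_mul _).aestronglyMeasurable) (.of_forall fun ω => ?_)
    simpa only [zero_mul, Pi.zero_apply] using hc.mul_const (W ω)
  rw [tendstoInMeasure_iff_norm] at hW ⊢
  intro δ hδ
  refine tendsto_of_tendsto_of_tendsto_of_le_of_le tendsto_const_nhds (hW δ hδ)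
    (fun _ => zero_le) fun n => ?_
  have hset : MeasurableSet {y : ℝ | δ ≤ ‖c n * y‖} :=
    measurableSet_le measurable_const (measurable_norm.comp (measurable_const_mul (c n)))
  calc P {ω | δ ≤ ‖f n ω - (0 : Ω → V) ω‖} ≤ P (Z n ⁻¹' {y | δ ≤ ‖c n * y‖}) := by
        refine measure_mono fun ω hω => ?_
        simp only [Pi.zero_apply, sub_zero, Set.mem_ofPred_eq] at hω
        exact hω.trans ((hf n ω).trans (le_abs_self _))
    _ = P (W ⁻¹' {y | δ ≤ ‖c n * y‖}) := (hZ n).measure_mem_eq hset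
    _ = P {ω | δ ≤ ‖c n * W ω - (0 : Ω → ℝ) ω‖} := by
        simp only [Pi.zero_apply, sub_zero, Set.preimage_ofPred_eq]

variable {N q : ℕ} {B : Fin q → Matrix (Fin N) (Fin N) ℝ} {m w : ℤ → Ω → Fin N → ℝ}

lemma tendstoInMeasure_companion_pow (hB : RootsOutsideUnitDisc B) (hm : ∀ t, Measurable (m t))
    (hstat : IsStationary P m) (t : ℤ) :
    TendstoInMeasure P (fun (n : ℕ) ω =>
      (companion B ^ n) (fun j : Fin (q + 1) => m (t - n - (j : ℕ)) ω)) atTop 0 := by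
  obtain ⟨K, r, -, hr0, hr1, hKr⟩ := exists_norm_companion_pow_le hB
  have hstate : Measurable fun (z : ℤ → Fin N → ℝ) (j : Fin (q + 1)) => z (-(j : ℕ)) := by fun_prop
  refine tendstoInMeasure_zero_of_norm_le_mul (c := fun n => K * r ^ n) ?_
    (fun n => hstat.identDistrib_shiftBy hm (measurable_norm.comp hstate) (t - n)) fun n ω => ?_
  · simpa only [mul_zero] using (tendsto_pow_atTop_nhds_zero_of_lt_one hr0.le hr1).const_mul K
  · simpa only [Function.comp_apply, shiftBy_apply, neg_add_eq_sub] using hKr n _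

-- The state at time `t - n` is bounded in probability by stationarity, and the `n`-th power of the
-- companion matrix kills it.
lemma ae_eq_filterState_of_isStationary (hB : RootsOutsideUnitDisc B)
    (hm : ∀ t, Measurable (m t)) (hstat : IsStationary P m)
    (hrec : ∀ t, ∀ᵐ ω ∂P,
      m t ω = ∑ j : Fin q, (B j).mulVec (m (t - ((j : ℕ) + 1)) ω) + w t ω)
    {t : ℤ} (hw : ∀ᵐ ω ∂P, Summable fun n : ℕ => impulse B n (w (t - n) ω)) :
    ∀ᵐ ω ∂P, m t ω = filterState B (fun s => w s ω) t 0 := by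
  have hlim : ∀ᵐ ω ∂P, Tendsto (fun n : ℕ =>
      (companion B ^ n) (fun j : Fin (q + 1) => m (t - n - (j : ℕ)) ω)) atTop
      (𝓝 ((fun j : Fin (q + 1) => m (t - (j : ℕ)) ω) - filterState B (fun s => w s ω) t)) := by
    filter_upwards [ae_all_iff.2 hrec, hw] with ω hω hwω
    exact tendsto_companion_pow_of_recursion (m := fun s => m s ω) hω hwω
  have hmeas (n : ℕ) : AEStronglyMeasurable (fun ω =>
      (companion B ^ n) (fun j : Fin (q + 1) => m (t - n - (j : ℕ)) ω)) P :=
    ((companion B ^ n).toContinuousLinearMap.continuous.measurable.comp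
      (measurable_pi_lambda _ fun j => hm _)).aestronglyMeasurable
  filter_upwards [tendstoInMeasure_ae_unique (tendstoInMeasure_of_tendsto_ae hmeas hlim)
    (tendstoInMeasure_companion_pow hB hm hstat t)] with ω hω
  simpa [sub_eq_zero] using congrFun hω 0

end StationaryRecursion

section CondProb

variable {Ω : Type*} {m mΩ : MeasurableSpace Ω} {P : Measure Ω} [IsFiniteMeasure P] {s : Set Ω}
  {g : Ω → ℝ≥0∞}

omit [IsFiniteMeasure P] in
lemma setIntegral_indicator_one_eq_measureReal (hs : MeasurableSet s) (D : Set Ω) :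
    ∫ ω in D, s.indicator (fun _ => (1 : ℝ)) ω ∂P = P.real (D ∩ s) := by
  rw [setIntegral_indicator hs, setIntegral_const, smul_eq_mul, mul_one]

lemma measure_inter_eq_setLIntegral_of_condExp_eq (hm : m ≤ mΩ) (hs : MeasurableSet s)
    (hg : Measurable g) (hg1 : ∀ ω, g ω ≤ 1) (h : P⟦s | m⟧ =ᵐ[P] fun ω => (g ω).toReal)
    {D : Set Ω} (hD : MeasurableSet[m] D) : P (D ∩ s) = ∫⁻ ω in D, g ω ∂P := by
  have hint : Integrable (s.indicator fun _ => (1 : ℝ)) P := (integrable_const 1).indicator hs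
  have hreal : P.real (D ∩ s) = (∫⁻ ω in D, g ω ∂P).toReal := by
    rw [← setIntegral_indicator_one_eq_measureReal hs, ← setIntegral_condExp hm hint hD,
      setIntegral_congr_ae (hm D hD) (h.mono fun ω hω _ => hω),
      integral_toReal hg.aemeasurable (.of_forall fun ω => (hg1 ω).trans_lt ENNReal.one_lt_top)]
  refine (ENNReal.toReal_eq_toReal_iff' (measure_ne_top _ _) ?_).1 hreal
  exact ((lintegral_mono hg1).trans_lt (by simp [measure_lt_top])).ne

lemma condExp_indicator_eq_of_measure_inter_eq (hm : m ≤ mΩ) (hs : MeasurableSet s)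
    (hg : Measurable[m] g) (hg1 : ∀ ω, g ω ≤ 1)
    (h : ∀ D, MeasurableSet[m] D → P (D ∩ s) = ∫⁻ ω in D, g ω ∂P) :
    P⟦s | m⟧ =ᵐ[P] fun ω => (g ω).toReal := by
  have hgm : Measurable[m] fun ω => (g ω).toReal := ENNReal.measurable_toReal.comp hg
  have hint : Integrable (fun ω => (g ω).toReal) P :=
    .of_bound (hgm.mono hm le_rfl).aestronglyMeasurable 1 (.of_forall fun ω => by
      simpa using ENNReal.toReal_mono ENNReal.one_ne_top (hg1 ω))
  refine (ae_eq_condExp_of_forall_setIntegral_eq hm ((integrable_const 1).indicator hs)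
    (fun _ _ _ => hint.integrableOn) (fun D hD _ => ?_)
    hgm.stronglyMeasurable.aestronglyMeasurable).symm
  rw [setIntegral_indicator_one_eq_measureReal hs, measureReal_def, h D hD,
    integral_toReal (hg.mono hm le_rfl).aemeasurable
      (.of_forall fun ω => (hg1 ω).trans_lt ENNReal.one_lt_top)]

end CondProb

section Past

variable {Ω α β C : Type*} [mα : MeasurableSpace α] [mβ : MeasurableSpace β] [MeasurableSpace C]
  {Y : ℤ → Ω → α} {X : ℤ → Ω → β} {t : ℤ}

lemma measurable_past_response {s : ℤ} (hs : s < t) : Measurable[pastAndCovariates Y X t] (Y s) :=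
  (comap_measurable (Y s)).mono
    ((le_iSup (fun s : Set.Iio t => mα.comap (Y s)) ⟨s, hs⟩).trans le_sup_left) le_rfl

lemma measurable_past_covariate (s : ℤ) : Measurable[pastAndCovariates Y X t] (X s) :=
  (comap_measurable (X s)).mono ((le_iSup (fun s => mβ.comap (X s)) s).trans le_sup_right) le_rfl

lemma pastAndCovariates_le [mΩ : MeasurableSpace Ω] (hY : ∀ s, Measurable (Y s))
    (hX : ∀ s, Measurable (X s)) : pastAndCovariates Y X t ≤ mΩ :=
  sup_le (iSup_le fun s => (hY s).comap_le) (iSup_le fun s => (hX s).comap_le)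

variable [Inhabited C]

lemma measurable_past_eraseFrom {f : α → C} (hf : Measurable f) :
    Measurable[pastAndCovariates Y X t]
      fun ω => eraseFrom t (fun s => X s ω, fun s => f (Y s ω)) := by
  let _ : MeasurableSpace Ω := pastAndCovariates Y X t
  refine Measurable.prodMk (measurable_pi_lambda _ measurable_past_covariate)
    (measurable_pi_lambda _ fun s => ?_)
  by_cases hs : s < t
  · simpa only [if_pos hs, Function.comp_def] using hf.comp (measurable_past_response hs)
  · simpa only [if_neg hs] using measurable_const

lemma exists_eraseFrom_preimage_of_measurableSet_past {f : C → α} (hf : Measurable f)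
    {S : ℤ → Ω → C} {D : Set Ω}
    (hD : MeasurableSet[pastAndCovariates (fun s ω => f (S s ω)) X t] D) :
    ∃ G, MeasurableSet G ∧ eraseFrom t ⁻¹' G = G ∧
      (fun ω => (fun s => X s ω, fun s => S s ω)) ⁻¹' G = D := by
  let R : Ω → (ℤ → β) × (ℤ → C) := fun ω => eraseFrom t (fun s => X s ω, fun s => S s ω)
  have hR := comap_measurable (m := inferInstance) R
  have hresponse (s : Set.Iio t) : (fun p => f (p.2 s)) ∘ R = fun ω => f (S s ω) :=
    funext fun ω => congrArg f (if_pos s.2)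
  have hle : pastAndCovariates (fun s ω => f (S s ω)) X t ≤
      MeasurableSpace.comap R inferInstance :=
    sup_le (iSup_le fun s => (hresponse s ▸
      (hf.comp ((measurable_pi_apply (s : ℤ)).comp measurable_snd)).comp hR).comap_le)
      (iSup_le fun s => (((measurable_pi_apply s).comp measurable_fst).comp hR).comap_le)
  obtain ⟨D', hD', rfl⟩ := hle D hD
  refine ⟨eraseFrom t ⁻¹' D', measurable_eraseFrom t hD', ?_, rfl⟩
  ext p
  simp only [Set.mem_preimage, eraseFrom_idem]

end Past

section Cell

variable {N : ℕ}

lemma support_indicatorVec (I : Set (Fin N)) : Function.support (indicatorVec I) = I := by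
  rw [indicatorVec, Set.support_indicator, Function.support_const one_ne_zero, Set.inter_univ]

lemma measurable_support : Measurable fun y : Fin N → ℝ => Function.support y :=
  measurable_set_iff.2 fun i => by
    have hi : MeasurableSet {y : Fin N → ℝ | y i ≠ 0} :=
      (measurableSet_singleton (0 : ℝ)).compl.preimage (measurable_pi_apply i)
    exact measurableSet_setOfPred.1 hi

variable (ν : Measure (Fin N → ℝ))

lemma measurable_measure_cell [SFinite ν] (I : Set (Fin N)) : Measurable fun c => ν (cell I c) := by
  simp only [← setOf_choose_eq]
  exact measurable_measure_prodMk_left (measurable_choose (measurableSet_singleton I))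

lemma tsum_measure_cell [IsProbabilityMeasure ν] (c : Fin N → ℝ) : ∑' I, ν (cell I c) = 1 := by
  have h := measure_eq_tsum_inter_fiber ν (measurable_choose.comp measurable_prodMk_left)
    (.univ : MeasurableSet (Set.univ : Set (Fin N → ℝ))) (f := choose c)
  simpa only [measure_univ, Set.univ_inter, setOf_choose_eq] using h.symm

end Cell

section SolutionPath

variable {N d p q : ℕ} (B : Fin q → Matrix (Fin N) (Fin N) ℝ)
  (A : Fin p → Matrix (Fin N) (Fin N) ℝ) (Γ : Matrix (Fin N) (Fin d) ℝ)

/-- The path of `(Y_t, μ_t, X_t)` which belongs to given covariates and chosen sets. -/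
noncomputable def solutionPath (c : (ℤ → Fin d → ℝ) × (ℤ → Set (Fin N))) (t : ℤ) :
    (Fin N → ℝ) × (Fin N → ℝ) × (Fin d → ℝ) :=
  (indicatorVec (c.2 t), latent B A Γ (shiftBy t c.1) (shiftBy t c.2), c.1 t)

lemma measurable_solutionPath : Measurable (solutionPath B A Γ) :=
  measurable_pi_lambda _ fun t =>
    ((Measurable.of_discrete (f := indicatorVec)).comp ((measurable_pi_apply t).comp
      measurable_snd)).prodMk
    (((measurable_latent B A Γ).comp (measurable_shiftPair t)).prodMk
      ((measurable_pi_apply t).comp measurable_fst))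

lemma semiconj_solutionPath : Function.Semiconj (solutionPath B A Γ) (shiftPair 1) shift := by
  intro c
  ext t : 1
  simp only [solutionPath, shift, shiftPair_fst, shiftPair_snd, shiftBy_shiftBy, shiftBy_apply]

lemma ergodic_map_solutionPath {ν : Measure (Fin N → ℝ)} [IsProbabilityMeasure ν]
    {lam : Measure (ℤ → Fin d → ℝ)} [IsProbabilityMeasure lam] (hlam : Ergodic shift lam) :
    Ergodic shift ((limitLaw lam ν (choiceResponse B A Γ)).map (solutionPath B A Γ)) :=
  ((measurable_solutionPath B A Γ).measurePreserving _).ergodic_of_ergodic_semiconj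
    ((isCausal_choiceResponse B A Γ).ergodic_limitLaw hlam) (measurable_shiftBy 1)
    (semiconj_solutionPath B A Γ)

end SolutionPath

section Uniqueness

variable {N d p q : ℕ} {Ω : Type*} [MeasurableSpace Ω] {ν : Measure (Fin N → ℝ)}
  [IsProbabilityMeasure ν] {B : Fin q → Matrix (Fin N) (Fin N) ℝ}
  {A : Fin p → Matrix (Fin N) (Fin N) ℝ} {Γ : Matrix (Fin N) (Fin d) ℝ} {P : Measure Ω}
  [IsProbabilityMeasure P] {X : ℤ → Ω → Fin d → ℝ} {Y μ : ℤ → Ω → Fin N → ℝ}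

/-- The paths of the covariates and of the chosen sets, which are the supports of the responses. -/
def covariatesAndChoices (X : ℤ → Ω → Fin d → ℝ) (Y : ℤ → Ω → Fin N → ℝ) (ω : Ω) :
    (ℤ → Fin d → ℝ) × (ℤ → Set (Fin N)) :=
  (fun s => X s ω, fun s => Function.support (Y s ω))

namespace IsStationarySolution

omit [IsProbabilityMeasure ν] [IsProbabilityMeasure P] in
lemma measurable_covariatesAndChoices (h : IsStationarySolution ν B A Γ P X Y μ) :
    Measurable (covariatesAndChoices X Y) :=
  (measurable_pi_lambda _ h.measurable_X).prodMk
    (measurable_pi_lambda _ fun s => measurable_support.comp (h.measurable_Y s))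

lemma measure_inter_eq (h : IsStationarySolution ν B A Γ P X Y μ) {t : ℤ} {D : Set Ω}
    (hD : MeasurableSet[pastAndCovariates Y X t] D) (I : Set (Fin N)) :
    P (D ∩ Y t ⁻¹' {indicatorVec I}) = ∫⁻ ω in D, ν (cell I (μ t ω)) ∂P :=
  measure_inter_eq_setLIntegral_of_condExp_eq (pastAndCovariates_le h.measurable_Y h.measurable_X)
    (h.measurable_Y t (measurableSet_singleton _))
    ((measurable_measure_cell ν I).comp (h.measurable_μ t)) (fun _ => prob_le_one)
    (h.condLaw t I) hD

lemma ae_eq_indicatorVec_support (h : IsStationarySolution ν B A Γ P X Y μ) (t : ℤ) :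
    ∀ᵐ ω ∂P, Y t ω = indicatorVec (Function.support (Y t ω)) := by
  have hsupport := measurable_support.comp (h.measurable_Y t)
  have hmeas : MeasurableSet {ω | Y t ω = indicatorVec (Function.support (Y t ω))} :=
    measurableSet_eq_fun (h.measurable_Y t)
      ((Measurable.of_discrete (f := indicatorVec)).comp hsupport)
  have hfiber (I : Set (Fin N)) : {ω | Y t ω = indicatorVec (Function.support (Y t ω))} ∩
      {ω | Function.support (Y t ω) = I} = Set.univ ∩ Y t ⁻¹' {indicatorVec I} := by
    ext ω
    constructor
    · rintro ⟨hω, rfl⟩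
      exact ⟨trivial, hω⟩
    · rintro ⟨-, hω : Y t ω = indicatorVec I⟩
      simp only [Set.mem_inter_iff, Set.mem_ofPred_eq, hω, support_indicatorVec, and_self]
  refine (mem_ae_iff_prob_eq_one hmeas).2 ?_
  calc P {ω | Y t ω = indicatorVec (Function.support (Y t ω))}
      = ∑' I, ∫⁻ ω, ν (cell I (μ t ω)) ∂P := by
        rw [measure_eq_tsum_inter_fiber P hsupport hmeas]
        refine tsum_congr fun I => ?_
        rw [← setLIntegral_univ, ← h.measure_inter_eq .univ I]
        exact congrArg P (hfiber I)
    _ = ∫⁻ ω, ∑' I, ν (cell I (μ t ω)) ∂P :=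
        (lintegral_tsum fun I =>
          ((measurable_measure_cell ν I).comp (h.measurable_μ t)).aemeasurable).symm
    _ = 1 := by simp only [tsum_measure_cell, lintegral_one, measure_univ]

lemma ae_eq_latent (h : IsStationarySolution ν B A Γ P X Y μ) (hB : RootsOutsideUnitDisc B)
    (hX : IsStationary P X) (hlog : Integrable (fun x => Real.posLog ‖x 0‖) (processLaw P X))
    (t : ℤ) :
    ∀ᵐ ω ∂P, μ t ω = latent B A Γ (shiftBy t (covariatesAndChoices X Y ω).1)
      (shiftBy t (covariatesAndChoices X Y ω).2) := by
  have hpath : Measurable fun ω t => X t ω := measurable_pi_lambda _ h.measurable_X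
  have hprob : IsProbabilityMeasure (processLaw P X) :=
    Measure.isProbabilityMeasure_map hpath.aemeasurable
  have hstat : IsStationary P μ := h.stationary.comp
    (fun t => (h.measurable_Y t).prodMk (h.measurable_μ t)) measurable_snd
  have hsum := ae_of_ae_map hpath.aemeasurable
    (ae_summable_impulse_mulVec (lam := processLaw P X) hB Γ hX hlog)
  simp only [latent_shiftBy]
  refine ae_eq_filterState_of_isStationary (w := fun t ω => input A Γ
    (covariatesAndChoices X Y ω).1 (covariatesAndChoices X Y ω).2 t)
    hB h.measurable_μ hstat (fun t => ?_) ?_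
  · filter_upwards [h.recursion t, ae_all_iff.2 h.ae_eq_indicatorVec_support] with ω hω hY
    rw [hω, add_assoc]
    simp only [input, feedback, covariatesAndChoices, ← hY]
  · filter_upwards [hsum] with ω hω
    exact summable_impulse_input A Γ hB (x := (covariatesAndChoices X Y ω).1) (hω t) _

lemma hasResponseLawAt (h : IsStationarySolution ν B A Γ P X Y μ) (hB : RootsOutsideUnitDisc B)
    (hX : IsStationary P X) (hlog : Integrable (fun x => Real.posLog ‖x 0‖) (processLaw P X))
    (t : ℤ) : HasResponseLawAt ν (choiceResponse B A Γ) (P.map (covariatesAndChoices X Y)) t := by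
  intro G hG hGt I
  have hR := h.measurable_covariatesAndChoices
  have hpast : MeasurableSet[pastAndCovariates Y X t] (covariatesAndChoices X Y ⁻¹' G) := by
    rw [← hGt]
    exact measurable_past_eraseFrom measurable_support hG
  have hchoice : covariatesAndChoices X Y ⁻¹' {c | c.2 t = I} =ᵐ[P] Y t ⁻¹' {indicatorVec I} := by
    filter_upwards [h.ae_eq_indicatorVec_support t] with ω hω
    refine propext ⟨fun hI : Function.support (Y t ω) = I => hω.trans (congrArg _ hI),
      fun hI : Y t ω = indicatorVec I => ?_⟩
    exact (congrArg Function.support hI).trans (support_indicatorVec I)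
  have hfiber : MeasurableSet {c : (ℤ → Fin d → ℝ) × (ℤ → Set (Fin N)) | c.2 t = I} :=
    (measurableSet_singleton I).preimage (by fun_prop)
  rw [setLIntegral_map hG ((isCausal_choiceResponse B A Γ).measurable_measure_response t I) hR,
    Measure.map_apply hR (hG.inter hfiber),
    Set.preimage_inter, measure_congr ((EventuallyEq.refl _ _).inter hchoice),
    h.measure_inter_eq hpast I]
  refine setLIntegral_congr_fun_ae (hR hG) ?_
  filter_upwards [h.ae_eq_latent hB hX hlog t] with ω hω _
  simp only [choiceResponse, setOf_choose_eq, ← hω]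

variable {U : ℕ → (ℤ → Fin d → ℝ) → (ℤ → Set (Fin N)) → Set (Fin N → ℝ)} {β : ℕ → ℝ≥0∞}

theorem processLaw_eq (h : IsStationarySolution ν B A Γ P X Y μ) (hB : RootsOutsideUnitDisc B)
    (hX : IsErgodic P X) (hlog : Integrable (fun x => Real.posLog ‖x 0‖) (processLaw P X))
    (hΦ : IsRegenerative ν (choiceResponse B A Γ) U β) :
    processLaw P (fun t ω => (Y t ω, μ t ω, X t ω)) =
      (limitLaw (processLaw P X) ν (choiceResponse B A Γ)).map (solutionPath B A Γ) := by
  have hR := h.measurable_covariatesAndChoices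
  have hpath : Measurable fun ω t => X t ω := measurable_pi_lambda _ h.measurable_X
  have hprob : IsProbabilityMeasure (processLaw P X) :=
    Measure.isProbabilityMeasure_map hpath.aemeasurable
  have hprobR : IsProbabilityMeasure (P.map (covariatesAndChoices X Y)) :=
    Measure.isProbabilityMeasure_map hR.aemeasurable
  have hfst : MeasurePreserving Prod.fst (P.map (covariatesAndChoices X Y)) (processLaw P X) :=
    ⟨measurable_fst, Measure.map_map measurable_fst hR⟩
  have hsolution : (fun ω t => (Y t ω, μ t ω, X t ω)) =ᵐ[P]
      solutionPath B A Γ ∘ covariatesAndChoices X Y := by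
    filter_upwards [ae_all_iff.2 (h.ae_eq_latent hB hX.toMeasurePreserving hlog),
      ae_all_iff.2 h.ae_eq_indicatorVec_support] with ω hμ hY
    ext t : 1
    exact Prod.ext (hY t) (Prod.ext (hμ t) rfl)
  rw [processLaw, Measure.map_congr hsolution,
    ← Measure.map_map (measurable_solutionPath B A Γ) hR, hΦ.eq_limitLaw hX hfst
      (h.hasResponseLawAt hB hX.toMeasurePreserving hlog)]

theorem isErgodic (h : IsStationarySolution ν B A Γ P X Y μ) (hB : RootsOutsideUnitDisc B)
    (hX : IsErgodic P X) (hlog : Integrable (fun x => Real.posLog ‖x 0‖) (processLaw P X))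
    (hΦ : IsRegenerative ν (choiceResponse B A Γ) U β) :
    IsErgodic P fun t ω => (Y t ω, μ t ω, X t ω) := by
  have hprob : IsProbabilityMeasure (processLaw P X) :=
    Measure.isProbabilityMeasure_map (measurable_pi_lambda _ h.measurable_X).aemeasurable
  rw [IsErgodic, h.processLaw_eq hB hX hlog hΦ]
  exact ergodic_map_solutionPath B A Γ hX

end IsStationarySolution

end Uniqueness

section GeneratedPath

variable {Ω α E C : Type*} [MeasurableSpace Ω] [MeasurableSpace α] [MeasurableSpace E]
  [MeasurableSpace C] [Inhabited C] {ν : Measure E} [IsProbabilityMeasure ν]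
  {Φ : (ℤ → α) → (ℤ → C) → E → C} {U : ℕ → (ℤ → α) → (ℤ → C) → Set E} {β : ℕ → ℝ≥0∞}
  {P : Measure Ω} [IsProbabilityMeasure P] {X : ℤ → Ω → α}

/-- The paths of the covariates and of the responses which they generate from the infinite past,
on the product of the probability space of the covariates with the space of noise paths. -/
noncomputable def generatedPath (Φ : (ℤ → α) → (ℤ → C) → E → C) (X : ℤ → Ω → α)
    (ω : Ω × (ℤ → E)) : (ℤ → α) × (ℤ → C) :=
  (fun s => X s ω.1, limitPath Φ (fun s => X s ω.1, ω.2))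

lemma measurePreserving_covariates_prodMk_noise (hX : ∀ t, Measurable (X t)) :
    MeasurePreserving (fun ω : Ω × (ℤ → E) => ((fun s => X s ω.1 : ℤ → α), ω.2))
      (P.prod (iidLaw ν)) ((processLaw P X).prod (iidLaw ν)) :=
  ((measurable_pi_lambda _ hX).measurePreserving P).prod (.id _)

lemma measurePreserving_noise (t : ℤ) :
    MeasurePreserving (fun ω : Ω × (ℤ → E) => ω.2 t) (P.prod (iidLaw ν)) ν :=
  (measurePreserving_eval_infinitePi (fun _ : ℤ => ν) t).comp measurePreserving_snd

lemma iIndepFun_noise : iIndepFun (fun (t : ℤ) (ω : Ω × (ℤ → E)) => ω.2 t) (P.prod (iidLaw ν)) := by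
  rw [iIndepFun_iff_map_fun_eq_infinitePi_map fun t => (measurePreserving_noise (ν := ν)
    (P := P) t).measurable]
  simp only [(measurePreserving_noise _).map_eq]
  exact measurePreserving_snd.map_eq

lemma IsRegenerative.ae_follows_generatedPath (h : IsRegenerative ν Φ U β)
    (hX : ∀ t, Measurable (X t)) (hXerg : IsErgodic P X) :
    ∀ᵐ ω ∂P.prod (iidLaw ν), ∀ t,
      Follows Φ (generatedPath Φ X ω).1 ω.2 (generatedPath Φ X ω).2 t := by
  have hprob : IsProbabilityMeasure (processLaw P X) :=
    Measure.isProbabilityMeasure_map (measurable_pi_lambda _ hX).aemeasurable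
  exact (measurePreserving_covariates_prodMk_noise hX).quasiMeasurePreserving.ae
    (h.ae_follows_limitPath hXerg)

variable [Countable C] [MeasurableSingletonClass C]

lemma IsCausal.measurable_generatedPath (hΦ : IsCausal Φ) (hX : ∀ t, Measurable (X t)) :
    Measurable (generatedPath Φ X) :=
  have hpath := (measurable_pi_lambda _ hX).comp measurable_fst
  hpath.prodMk (hΦ.measurable_limitPath.comp (hpath.prodMk measurable_snd))

lemma IsCausal.map_generatedPath (hΦ : IsCausal Φ) (hX : ∀ t, Measurable (X t)) :
    (P.prod (iidLaw ν)).map (generatedPath Φ X) = limitLaw (processLaw P X) ν Φ := by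
  have hpath := measurePreserving_covariates_prodMk_noise (P := P) (ν := ν) hX
  rw [limitLaw, ← hpath.map_eq,
    Measure.map_map (measurable_fst.prodMk hΦ.measurable_limitPath) hpath.measurable]
  rfl

lemma IsRegenerative.hasResponseLawAt_map_generatedPath (h : IsRegenerative ν Φ U β)
    (hX : ∀ t, Measurable (X t)) (hXerg : IsErgodic P X) (t : ℤ) :
    HasResponseLawAt ν Φ ((P.prod (iidLaw ν)).map (generatedPath Φ X)) t := by
  refine h.hasResponseLawAt_map P (h.measurable_generatedPath hX) (fun ω e e₀ => ?_)
    ((h.ae_follows_generatedPath hX hXerg).mono fun ω hω => hω t)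
  exact eraseFrom_eq_iff.2 fun s hs => h.limitPath_congr_noise fun r hr =>
    Function.update_of_ne (hr.trans_lt hs).ne _ _

end GeneratedPath

section Existence

variable {N d p q : ℕ} {Ω : Type*} [MeasurableSpace Ω] {ν : Measure (Fin N → ℝ)}
  [IsProbabilityMeasure ν] {B : Fin q → Matrix (Fin N) (Fin N) ℝ}
  {A : Fin p → Matrix (Fin N) (Fin N) ℝ} {Γ : Matrix (Fin N) (Fin d) ℝ} {P : Measure Ω}
  [IsProbabilityMeasure P] {X : ℤ → Ω → Fin d → ℝ}

/-- The process `(Y_t, μ_t, X_t)` in which the choices are generated from the infinite past. -/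
noncomputable def generatedSolution (B : Fin q → Matrix (Fin N) (Fin N) ℝ)
    (A : Fin p → Matrix (Fin N) (Fin N) ℝ) (Γ : Matrix (Fin N) (Fin d) ℝ) (X : ℤ → Ω → Fin d → ℝ)
    (t : ℤ) (ω : Ω × (ℤ → Fin N → ℝ)) : (Fin N → ℝ) × (Fin N → ℝ) × (Fin d → ℝ) :=
  solutionPath B A Γ (generatedPath (choiceResponse B A Γ) X ω) t

lemma measurable_generatedSolution (hX : ∀ t, Measurable (X t)) (t : ℤ) :
    Measurable (generatedSolution B A Γ X t) :=
  (measurable_pi_apply t).comp ((measurable_solutionPath B A Γ).comp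
    ((isCausal_choiceResponse B A Γ).measurable_generatedPath hX))

lemma isErgodic_generatedSolution (hX : ∀ t, Measurable (X t)) (hXerg : IsErgodic P X) :
    IsErgodic (P.prod (iidLaw ν)) (generatedSolution B A Γ X) := by
  have hΦ := isCausal_choiceResponse B A Γ
  have hprob : IsProbabilityMeasure (processLaw P X) :=
    Measure.isProbabilityMeasure_map (measurable_pi_lambda _ hX).aemeasurable
  have hlaw : processLaw (P.prod (iidLaw ν)) (generatedSolution B A Γ X) =
      (limitLaw (processLaw P X) ν (choiceResponse B A Γ)).map (solutionPath B A Γ) := by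
    rw [← hΦ.map_generatedPath hX,
      Measure.map_map (measurable_solutionPath B A Γ) (hΦ.measurable_generatedPath hX)]
    rfl
  rw [IsErgodic, hlaw]
  exact ergodic_map_solutionPath B A Γ hXerg

omit [MeasurableSpace Ω] [IsProbabilityMeasure ν] [IsProbabilityMeasure P] in
lemma measurable_past_measure_cell_generatedSolution [SFinite ν] (t : ℤ) (I : Set (Fin N)) :
    Measurable[pastAndCovariates (fun s ω => (generatedSolution B A Γ X s ω).1)
      (fun s ω => X s ω.1) t] fun ω => ν (cell I (generatedSolution B A Γ X t ω).2.1) := by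
  have hΦ := isCausal_choiceResponse B A Γ
  have hpast := (hΦ.measurable_measure_response (ν := ν) t I).comp
    (measurable_past_eraseFrom (t := t) (Y := fun s ω => (generatedSolution B A Γ X s ω).1)
      (X := fun s ω => X s ω.1) measurable_support)
  convert hpast using 2 with ω
  simp only [generatedSolution, solutionPath, support_indicatorVec, Function.comp_apply,
    hΦ.response_eraseFrom]
  rw [← setOf_choose_eq]
  rfl

lemma condExp_choice_generatedSolution {U : ℕ → (ℤ → Fin d → ℝ) → (ℤ → Set (Fin N)) →
      Set (Fin N → ℝ)} {β : ℕ → ℝ≥0∞} (h : IsRegenerative ν (choiceResponse B A Γ) U β)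
    (hX : ∀ t, Measurable (X t)) (hXerg : IsErgodic P X) (t : ℤ) (I : Set (Fin N)) :
    (P.prod (iidLaw ν))⟦(fun ω => (generatedSolution B A Γ X t ω).1) ⁻¹' {indicatorVec I} |
      pastAndCovariates (fun s ω => (generatedSolution B A Γ X s ω).1) (fun s ω => X s ω.1) t⟧
        =ᵐ[P.prod (iidLaw ν)] fun ω => ν.real (cell I (generatedSolution B A Γ X t ω).2.1) := by
  have hY (s : ℤ) := measurable_fst.comp (measurable_generatedSolution (B := B) (A := A) (Γ := Γ)
    hX s)
  have hF := h.measurable_generatedPath hX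
  have hchoice : (fun ω => (generatedSolution B A Γ X t ω).1) ⁻¹' {indicatorVec I} =
      generatedPath (choiceResponse B A Γ) X ⁻¹' {c | c.2 t = I} := by
    ext ω
    exact (Function.LeftInverse.injective support_indicatorVec).eq_iff
  have hfiber : MeasurableSet {c : (ℤ → Fin d → ℝ) × (ℤ → Set (Fin N)) | c.2 t = I} :=
    (measurableSet_singleton I).preimage (by fun_prop)
  refine condExp_indicator_eq_of_measure_inter_eq
    (pastAndCovariates_le hY fun s => (hX s).comp measurable_fst)
    (hY t (measurableSet_singleton _)) (measurable_past_measure_cell_generatedSolution t I)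
    (fun _ => prob_le_one) fun D hD => ?_
  obtain ⟨G, hG, hGt, rfl⟩ := exists_eraseFrom_preimage_of_measurableSet_past
    (f := indicatorVec) (S := fun s ω => (generatedPath (choiceResponse B A Γ) X ω).2 s)
    .of_discrete hD
  have hresponse := h.hasResponseLawAt_map_generatedPath hX hXerg t G hG hGt I
  rw [Measure.map_apply hF (hG.inter hfiber), Set.preimage_inter,
    setLIntegral_map hG (h.measurable_measure_response t I) hF] at hresponse
  simp only [choiceResponse, setOf_choose_eq] at hresponse
  rw [hchoice]
  exact hresponse

theorem isStationarySolution_generatedSolution (hX : ∀ t, Measurable (X t))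
    (hXerg : IsErgodic P X) (hB : RootsOutsideUnitDisc B)
    (hlog : Integrable (fun x => Real.posLog ‖x 0‖) (processLaw P X))
    {U : ℕ → (ℤ → Fin d → ℝ) → (ℤ → Set (Fin N)) → Set (Fin N → ℝ)} {β : ℕ → ℝ≥0∞}
    (h : IsRegenerative ν (choiceResponse B A Γ) U β) :
    IsStationarySolution ν B A Γ (P.prod (iidLaw ν)) (fun t ω => X t ω.1)
      (fun t ω => (generatedSolution B A Γ X t ω).1)
      (fun t ω => (generatedSolution B A Γ X t ω).2.1) where
  measurable_X t := (hX t).comp measurable_fst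
  measurable_Y t := measurable_fst.comp (measurable_generatedSolution hX t)
  measurable_μ t := (measurable_fst.comp measurable_snd).comp (measurable_generatedSolution hX t)
  recursion t := by
    have hpath := (measurable_pi_lambda _ hX).measurePreserving P
    have hprob : IsProbabilityMeasure (processLaw P X) :=
      Measure.isProbabilityMeasure_map hpath.aemeasurable
    have hsum := ae_summable_impulse_mulVec (lam := processLaw P X) hB Γ
      hXerg.toMeasurePreserving hlog
    filter_upwards [(hpath.comp (measurePreserving_fst (ν := iidLaw ν))).quasiMeasurePreserving.ae
      hsum] with ω hω
    simp only [generatedSolution, solutionPath, latent_shiftBy]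
    rw [add_assoc]
    exact filterState_recursion (fun s => summable_impulse_input A Γ hB (hω s) _) t
  condLaw := condExp_choice_generatedSolution h hX hXerg
  stationary := IsStationary.comp (isErgodic_generatedSolution hX hXerg).toMeasurePreserving
    (measurable_generatedSolution hX)
    (measurable_fst.prodMk (measurable_fst.comp measurable_snd))

theorem isGeneratedByNoise_generatedSolution (hX : ∀ t, Measurable (X t))
    (hXerg : IsErgodic P X)
    {U : ℕ → (ℤ → Fin d → ℝ) → (ℤ → Set (Fin N)) → Set (Fin N → ℝ)} {β : ℕ → ℝ≥0∞}
    (h : IsRegenerative ν (choiceResponse B A Γ) U β) :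
    IsGeneratedByNoise ν (P.prod (iidLaw ν)) (fun t ω => X t ω.1)
      (fun t ω => (generatedSolution B A Γ X t ω).1)
      (fun t ω => (generatedSolution B A Γ X t ω).2.1) (fun t ω => ω.2 t) where
  measurable_ε t := (measurable_pi_apply t).comp measurable_snd
  law_ε t := (measurePreserving_noise t).map_eq
  iIndep_ε := iIndepFun_noise
  indep_X := (indepFun_prod (X := fun ω t => X t ω) (Y := id) (measurable_pi_lambda _ hX)
    measurable_id).symm
  choice t := by
    filter_upwards [h.ae_follows_generatedPath hX hXerg] with ω hω
    exact congrArg indicatorVec (hω t)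

end Existence

end DiscreteChoice

theorem proposition5 {N d p q : ℕ}
    (B : Fin q → Matrix (Fin N) (Fin N) ℝ) (A : Fin p → Matrix (Fin N) (Fin N) ℝ)
    (Γ : Matrix (Fin N) (Fin d) ℝ)
    -- the stationary ergodic covariate process, with a logarithmic moment
    {Ω₀ : Type u} [MeasurableSpace Ω₀] (P₀ : Measure Ω₀) [IsProbabilityMeasure P₀]
    (X : ℤ → Ω₀ → (Fin d → ℝ)) (hX : ∀ t, Measurable (X t))
    (hXstat : DiscreteChoice.IsStationary P₀ X) (hXerg : DiscreteChoice.IsErgodic P₀ X)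
    (hXlog : Integrable (fun ω => Real.posLog ‖X 0 ω‖) P₀)
    -- the distribution of the noise: full support and Lipschitz c.d.f.
    (ν : Measure (Fin N → ℝ)) [IsProbabilityMeasure ν]
    (hνsupp : ν.support = Set.univ)
    (hνLip : ∃ K : NNReal, LipschitzWith K (DiscreteChoice.jointCdf ν))
    -- the stability condition
    (hB : DiscreteChoice.RootsOutsideUnitDisc B) :
    -- existence of a stationary solution, on an enlargement of the probability space of `X`
    (∃ (Ω : Type u) (_ : MeasurableSpace Ω) (P : Measure Ω) (π : Ω → Ω₀)
        (Y μ ε : ℤ → Ω → (Fin N → ℝ)),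
      IsProbabilityMeasure P ∧ MeasurePreserving π P P₀ ∧
      DiscreteChoice.IsStationarySolution ν B A Γ P (fun t ω => X t (π ω)) Y μ ∧
      DiscreteChoice.IsGeneratedByNoise ν P (fun t ω => X t (π ω)) Y μ ε) ∧
    -- uniqueness (in law)
    (∀ {Ω₁ : Type v} {Ω₂ : Type w} [MeasurableSpace Ω₁] [MeasurableSpace Ω₂]
        (P₁ : Measure Ω₁) (P₂ : Measure Ω₂) [IsProbabilityMeasure P₁] [IsProbabilityMeasure P₂]
        (X₁ : ℤ → Ω₁ → (Fin d → ℝ)) (Y₁ μ₁ : ℤ → Ω₁ → (Fin N → ℝ))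
        (X₂ : ℤ → Ω₂ → (Fin d → ℝ)) (Y₂ μ₂ : ℤ → Ω₂ → (Fin N → ℝ)),
      DiscreteChoice.processLaw P₁ X₁ = DiscreteChoice.processLaw P₀ X →
      DiscreteChoice.processLaw P₂ X₂ = DiscreteChoice.processLaw P₀ X →
      DiscreteChoice.IsStationarySolution ν B A Γ P₁ X₁ Y₁ μ₁ →
      DiscreteChoice.IsStationarySolution ν B A Γ P₂ X₂ Y₂ μ₂ →
      DiscreteChoice.processLaw P₁ (fun t ω => (Y₁ t ω, μ₁ t ω, X₁ t ω)) =
        DiscreteChoice.processLaw P₂ (fun t ω => (Y₂ t ω, μ₂ t ω, X₂ t ω))) ∧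
    -- stationarity and ergodicity of `(Y_t, X_t)` for the stationary solution
    (∀ {Ω : Type r} [MeasurableSpace Ω] (P : Measure Ω) [IsProbabilityMeasure P]
        (X' : ℤ → Ω → (Fin d → ℝ)) (Y μ : ℤ → Ω → (Fin N → ℝ)),
      DiscreteChoice.processLaw P X' = DiscreteChoice.processLaw P₀ X →
      DiscreteChoice.IsStationarySolution ν B A Γ P X' Y μ →
      DiscreteChoice.IsStationary P (fun t ω => (Y t ω, X' t ω)) ∧
        DiscreteChoice.IsErgodic P (fun t ω => (Y t ω, X' t ω))) := by
  obtain ⟨U, β, hΦ⟩ := DiscreteChoice.exists_isRegenerative_choiceResponse A Γ hB hνsupp hνLip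
  have hposLog : Measurable fun x : ℤ → Fin d → ℝ => Real.posLog ‖x 0‖ :=
    Real.continuous_posLog.measurable.comp (measurable_pi_apply 0).norm
  have hlog : Integrable (fun x : ℤ → Fin d → ℝ => Real.posLog ‖x 0‖)
      (DiscreteChoice.processLaw P₀ X) :=
    (integrable_map_measure hposLog.aestronglyMeasurable
      (measurable_pi_lambda _ hX).aemeasurable).2 hXlog
  refine ⟨⟨Ω₀ × (ℤ → Fin N → ℝ), inferInstance, P₀.prod (DiscreteChoice.iidLaw ν), Prod.fst, _, _,
    _, inferInstance, measurePreserving_fst,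
    DiscreteChoice.isStationarySolution_generatedSolution hX hXerg hB hlog hΦ,
    DiscreteChoice.isGeneratedByNoise_generatedSolution hX hXerg hΦ⟩, ?_, ?_⟩
  · intro Ω₁ Ω₂ _ _ P₁ P₂ _ _ X₁ Y₁ μ₁ X₂ Y₂ μ₂ hX₁ hX₂ h₁ h₂
    have hlaw₁ := h₁.processLaw_eq hB (by rwa [DiscreteChoice.IsErgodic, hX₁]) (by rwa [hX₁]) hΦ
    have hlaw₂ := h₂.processLaw_eq hB (by rwa [DiscreteChoice.IsErgodic, hX₂]) (by rwa [hX₂]) hΦ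
    rw [hlaw₁, hlaw₂, hX₁, hX₂]
  · intro Ω _ P _ X' Y μ hX' h
    have herg := h.isErgodic hB (by rwa [DiscreteChoice.IsErgodic, hX']) (by rwa [hX']) hΦ
    have hpair : DiscreteChoice.IsErgodic P fun t ω => (Y t ω, X' t ω) := herg.comp
      (fun t => (h.measurable_Y t).prodMk ((h.measurable_μ t).prodMk (h.measurable_X t)))
      (measurable_fst.prodMk (measurable_snd.comp measurable_snd))
    exact ⟨hpair.toMeasurePreserving, hpair⟩
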